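/- **Pattern.** A 1-periodic pattern $\mathcal G$ is a finite collection of $C^2$ curves (up to their end points, parametrized by arc length $s$) in the flat torus $\mathbb R^2/\mathbb Z^2$, extended periodically to $\mathbb R^2$. In the torus, each curve is simple, except that its two end points may coincide, and two different curves meet at most at end points of both of them. Let $\Gamma_1$ be the union of the curves in one period cell, $l$ its total length, and $\Box=(0,1)^2$. The *nodes* are the end points of arcs, except that the base point of a $C^2$ closed curve at which no other curve ends is not a node. The pattern is *regular* if at each node the arcs that approach it are mutually nontangential, that is, they leave the node in pairwise different directions (opposite directions are allowed). **Effective diffusion tensor.** Let $a>0$. Let $H^1_{per}(\Box)$ be the completion of the smooth 1-periodic functions on $\mathbb R^2$ in the norm of $H^1(\Box)$, and $$Z=\Big\{v\in H^1_{per}(\Box):\ v|_\gamma\in H^1(\gamma)\ \text{for all }\gamma\in\mathcal G,\ \int_\Box v=0\Big\},$$ where $v|_\gamma$ is the trace. For $k=1,2$ let $\hat w_k\in Z$ be the weak solution of $$\int_\Box \nabla \hat w_k\cdot\nabla v+a\int_{\Gamma_1}(\hat w_k)_s v_s\,ds+a\int_{\Gamma_1}(x_k)_s v_s\,ds=0\qquad\text{for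 all }v\in Z,$$ and put $$(\Sigma_0)_{kl}=\delta_{kl}+a\int_{\Gamma_1}(\hat w_k+x_k)_s\,(x_l)_s\,ds ,\qquad k,l=1,2.$$ **Theorem.** For every regular 1-periodic pattern $\mathcal G$ of total length $l$ in the unit cell and every $a>0$, the tensor $\Sigma_0$ is well defined (it exists and is unique) and $$\operatorname{tr}(\Sigma_0)\le 2+a\,l .$$ Equality holds if and only if $\mathcal G$ is *balanced*, which means that, in the periodic extension to $\mathbb R^2$: 1. every arc is straight; 2. at least two different arcs join at each node; 3. at each node $V$, if $\gamma_1,\dots,\gamma_m$ are the distinct segments of the periodic extension that join at $V$ and $V_i$ is the other end point of $\gamma_i$, then $\displaystyle\sum_{i=1}^m\frac{V-V_i}{|V-V_i|}=\mathbf 0$. -/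

import Mathlib

open MeasureTheory Filter Topology
open scoped ContDiff

/-- The Euclidean plane. -/
abbrev Plane : Type := EuclideanSpace ℝ (Fin 2)

/-- The integer vector `m`, seen in the plane. -/
noncomputable def latticeVec (m : Fin 2 → ℤ) : Plane := WithLp.toLp 2 (fun i => (m i : ℝ))

/-- The open unit cell `(0,1)²`. -/
def unitCell : Set Plane := {x | ∀ i, x i ∈ Set.Ioo (0 : ℝ) 1}

/-- Functions on the plane that are 1-periodic in both variables. -/
def IsOnePeriodic (f : Plane → ℝ) : Prop := ∀ (m : Fin 2 → ℤ) (x : Plane), f (x + latticeVec m) = f x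

/-- A 1-periodic pattern: a finite collection of `n` curves of class `C²` (up to the end points) in
the flat torus `ℝ²/ℤ²`, any two of which meet at most at end points.  The `i`-th curve is given by
a lift to the plane, parametrized by arc length on `[0, length i]`.  The periodic extension of the
pattern to the plane consists of all the translates `curve i + latticeVec m`. -/
structure PeriodicPattern (n : ℕ) where
  /-- the length of the `i`-th curve -/
  length : Fin n → ℝ
  /-- a lift of the `i`-th curve -/
  curve : Fin n → ℝ → Plane
  length_pos : ∀ i, 0 < length i
  contDiffOn_curve : ∀ i, ContDiffOn ℝ 2 (curve i) (Set.Icc 0 (length i))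
  unit_speed : ∀ i, ∀ s ∈ Set.Icc 0 (length i),
    ‖derivWithin (curve i) (Set.Icc 0 (length i)) s‖ = 1
  /-- In the torus, each curve is simple except that its two end points may coincide, and different
  curves have no common points except end points of both of them. -/
  meet_at_ends : ∀ (i j : Fin n) (m : Fin 2 → ℤ), ∀ s ∈ Set.Icc 0 (length i),
    ∀ t ∈ Set.Icc 0 (length j), curve i s = curve j t + latticeVec m →
      (i = j ∧ s = t) ∨ ((s = 0 ∨ s = length i) ∧ (t = 0 ∨ t = length j))

namespace PeriodicPattern

/-- The total length of the pattern in one period cell. -/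
noncomputable def totalLength {n : ℕ} (P : PeriodicPattern n) : ℝ := ∑ i, P.length i

/-- The unit tangent vector of the `i`-th curve at arc length `s`. Its `k`-th coordinate is the
arc-length derivative of the coordinate function `x_k` along the curve. -/
noncomputable def tangent {n : ℕ} (P : PeriodicPattern n) (i : Fin n) (s : ℝ) : Plane :=
  derivWithin (P.curve i) (Set.Icc 0 (P.length i)) s

/-- The two end points of the lifted `i`-th curve: the initial one (`false`) and the final one
(`true`). -/
noncomputable def endPoint {n : ℕ} (P : PeriodicPattern n) (i : Fin n) (b : Bool) : Plane :=
  if b then P.curve i (P.length i) else P.curve i 0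

/-- The unit tangent vector at an end point that points into the curve. -/
noncomputable def endTangent {n : ℕ} (P : PeriodicPattern n) (i : Fin n) (b : Bool) : Plane :=
  if b then -P.tangent i (P.length i) else P.tangent i 0

/-- A translate (by an integer vector) of the `i`-th curve has its end `b` at the point `V`.
As the translation vector is then unique, the pairs `(i, b)` with this property are exactly the
ends of arcs of the periodic extension that lie at `V`. -/
def EndsAt {n : ℕ} (P : PeriodicPattern n) (i : Fin n) (b : Bool) (V : Plane) : Prop :=
  ∃ m : Fin 2 → ℤ, V = P.endPoint i b + latticeVec m

/-- The arc `curve p.1 + latticeVec p.2` of the periodic extension has `V` as an end point. -/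
def JoinsAt {n : ℕ} (P : PeriodicPattern n) (p : Fin n × (Fin 2 → ℤ)) (V : Plane) : Prop :=
  ∃ b : Bool, V = P.endPoint p.1 b + latticeVec p.2

/-- In the torus, the `i`-th curve is a closed curve, of class `C²` also at its base point. -/
def IsSmoothClosed {n : ℕ} (P : PeriodicPattern n) (i : Fin n) : Prop :=
  (∃ m : Fin 2 → ℤ, P.curve i (P.length i) = P.curve i 0 + latticeVec m) ∧
  P.tangent i (P.length i) = P.tangent i 0 ∧
  derivWithin (P.tangent i) (Set.Icc 0 (P.length i)) (P.length i) =
    derivWithin (P.tangent i) (Set.Icc 0 (P.length i)) 0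

/-- The nodes (conic points, intersection points, end points) of the periodic extension: the end
points of its arcs, except for the base point of a smooth closed curve at which no other curve
ends. -/
def IsNode {n : ℕ} (P : PeriodicPattern n) (V : Plane) : Prop :=
  (∃ i b, P.EndsAt i b V) ∧
  ¬ ∃ i, P.IsSmoothClosed i ∧ P.EndsAt i false V ∧ ∀ j c, P.EndsAt j c V → j = i

/-- A pattern is regular if the arcs that approach a node are mutually nontangential: they leave
the node in pairwise different directions. (Opposite directions are allowed: two arcs may continue
each other through a node.) -/
def IsRegular {n : ℕ} (P : PeriodicPattern n) : Prop :=
  ∀ V, P.IsNode V → ∀ i b j c, P.EndsAt i b V → P.EndsAt j c V → (i, b) ≠ (j, c) →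
    P.endTangent i b ≠ P.endTangent j c

/-- The `i`-th arc is straight: it is affine in arc length. -/
def IsStraight {n : ℕ} (P : PeriodicPattern n) (i : Fin n) : Prop :=
  ∃ u : Plane, ∀ s ∈ Set.Icc 0 (P.length i), P.curve i s = P.curve i 0 + s • u

open Classical in
/-- The sum, over all the arcs of the periodic extension that end at `V`, of the unit vectors
`(V - V') / |V - V'|`, where `V'` is the other end point of the arc. (Both vectors `V` and `V'`
are translated by the same integer vector, which does not change their difference.) -/
noncomputable def balanceSum {n : ℕ} (P : PeriodicPattern n) (V : Plane) : Plane :=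
  ∑ i : Fin n, ∑ b : Bool, if P.EndsAt i b V then
    ‖P.endPoint i b - P.endPoint i (!b)‖⁻¹ • (P.endPoint i b - P.endPoint i (!b)) else 0

/-- Balanced patterns: every arc is straight, at least two different arcs join at each node, and
the balance condition holds at each node. -/
def IsBalanced {n : ℕ} (P : PeriodicPattern n) : Prop :=
  (∀ i, P.IsStraight i) ∧
  (∀ V, P.IsNode V → ∃ p q, p ≠ q ∧ P.JoinsAt p V ∧ P.JoinsAt q V) ∧
  (∀ V, P.IsNode V → P.balanceSum V = 0)

/-- An element of the space of the functions `v ∈ H¹_per` of mean zero over the unit cell whose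
trace on each curve `γ` of the pattern belongs to `H¹(γ)`, recorded with its weak gradient, its
traces (as functions of arc length, in their continuous representatives) and the arc-length
derivatives of the traces.

`H¹_per` is the completion of the smooth 1-periodic functions in the norm of `H¹` of the unit cell,
and the trace is the extension by continuity of the restriction of smooth 1-periodic functions to
the curves, with values in `L²` of the curves (`approx`). A function belongs to `H¹` of an interval
if it is the integral of an `L²` function (`memLp_traceDeriv`, `trace_eq`). -/
structure CellFunction {n : ℕ} (P : PeriodicPattern n) where
  /-- the function -/
  val : Plane → ℝ
  /-- its weak gradient -/
  grad : Plane → Plane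
  /-- its trace on the `i`-th curve -/
  trace : Fin n → ℝ → ℝ
  /-- the arc-length derivative of the trace on the `i`-th curve -/
  traceDeriv : Fin n → ℝ → ℝ
  memLp_val : MemLp val 2 (volume.restrict unitCell)
  memLp_grad : MemLp grad 2 (volume.restrict unitCell)
  approx : ∃ φ : ℕ → Plane → ℝ, (∀ j, ContDiff ℝ ∞ (φ j) ∧ IsOnePeriodic (φ j)) ∧
    Tendsto (fun j => eLpNorm (fun x => φ j x - val x) 2 (volume.restrict unitCell))
      atTop (𝓝 0) ∧
    Tendsto (fun j => eLpNorm (fun x => gradient (φ j) x - grad x) 2 (volume.restrict unitCell))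
      atTop (𝓝 0) ∧
    ∀ i, Tendsto (fun j => eLpNorm (fun s => φ j (P.curve i s) - trace i s) 2
      (volume.restrict (Set.Icc 0 (P.length i)))) atTop (𝓝 0)
  memLp_traceDeriv : ∀ i, MemLp (traceDeriv i) 2 (volume.restrict (Set.Icc 0 (P.length i)))
  trace_eq : ∀ i, ∀ s ∈ Set.Icc 0 (P.length i),
    trace i s = trace i 0 + ∫ t in (0 : ℝ)..s, traceDeriv i t
  mean_zero : ∫ x in unitCell, val x = 0

/-- `w` is a weak solution of the `k`-th effective corrector problem with road effective
diffusivity `a`: for all admissible `v`,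
`∫_□ ∇w·∇v + a ∫_Γ w_s v_s + a ∫_Γ (x_k)_s v_s = 0`. -/
def IsCorrector {n : ℕ} (P : PeriodicPattern n) (a : ℝ) (k : Fin 2) (w : P.CellFunction) : Prop :=
  ∀ v : P.CellFunction,
    (∫ x in unitCell, inner ℝ (w.grad x) (v.grad x)) +
      a * (∑ i, ∫ s in (0 : ℝ)..P.length i, w.traceDeriv i s * v.traceDeriv i s) +
      a * (∑ i, ∫ s in (0 : ℝ)..P.length i, P.tangent i s k * v.traceDeriv i s) = 0

/-- `S` is the effective diffusion tensor `Σ₀` of the pattern `P` with road effective diffusivity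
`a`: `S k l = δ_kl + a ∫_Γ (w_k + x_k)_s (x_l)_s ds`, where `w_k` solves the `k`-th effective
corrector problem. -/
def IsEffectiveTensor {n : ℕ} (P : PeriodicPattern n) (a : ℝ) (S : Matrix (Fin 2) (Fin 2) ℝ) :
    Prop :=
  ∃ w : Fin 2 → P.CellFunction, (∀ k, P.IsCorrector a k (w k)) ∧
    ∀ k l, S k l = (if k = l then 1 else 0) + a * ∑ i, ∫ s in (0 : ℝ)..P.length i,
      ((w k).traceDeriv i s + P.tangent i s k) * P.tangent i s l

end PeriodicPattern

/-! Write E for `dirichletForm` and call `pull k v` the sum over the arcs of the integrals of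
(x_k)_s v_s. The corrector equation reads E(w_k, v) = -a `pull k v`. Taking v = w_k turns the
diagonal entry of the tensor into 1 + a ∫ (x_k)_s² - E(w_k, w_k). The tangents are unit vectors, so
summing over k gives tr Σ₀ = 2 + a l - ∑ E(w_k, w_k) (`trace_eq_sub_dirichletForm`). The inequality
follows because E is nonnegative. Equality holds exactly when both correctors have zero energy, that
is, when `pull` vanishes identically (`IsCritical`). It remains to see that critical and balanced
patterns are the same.

Critical implies balanced. `pull k φ` is the first variation of length in the direction φ e_k.
Integration by parts along the arcs splits it into curvature integrals and end point terms. A bump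
at an interior point of an arc shows that the curvature vanishes; a bump at a node then shows that
the unit tangents leaving it sum to zero.

Balanced implies critical. On straight arcs `pull` reduces to the values of the traces at the ends,
weighted by the tangents. These terms cancel node by node provided that all traces meeting at a node
have the same value there. H¹ functions of two variables have no point values, so this needs an
argument (`CellFunction.trace_end_eq`). Along two rays from V, the squared difference of φ at radius
r is at most 2π times the integral of |∂φ/∂θ|² over the circle. Hence the integral of that squared
difference against dr/r is bounded by the Dirichlet integral. The difference of the traces inherits
the bound, and since it is continuous in r, a nonzero limit at r = 0 would make the integral diverge
logarithmically.

Existence of correctors is an orthogonal projection in the Hilbert space of pairs (∇v, √a v_s). The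
admissible pairs form a closed subspace because the Poincaré and trace inequalities recover v and
its traces from the energy. Uniqueness of the tensor holds because the difference of two correctors
has zero energy. -/

/-! ### Coordinates and slicing of integrals over the unit cell -/

/-- The point of the plane whose `k`-th coordinate is `x` and whose other coordinate is `y`. -/
noncomputable def planePoint (k : Fin 2) (x y : ℝ) : Plane :=
  WithLp.toLp 2 (fun i => if i = k then x else y)

theorem planePoint_coords (k : Fin 2) (z : Plane) : planePoint k (z k) (z (1 - k)) = z := by
  ext i
  fin_cases k <;> fin_cases i <;> simp [planePoint]

theorem planePoint_add (k : Fin 2) (x y x' y' : ℝ) :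
    planePoint k (x + x') (y + y') = planePoint k x y + planePoint k x' y' := by
  ext i
  simp only [planePoint, PiLp.add_apply]
  split_ifs <;> rfl

theorem planePoint_int (k : Fin 2) (p q : ℤ) :
    planePoint k p q = latticeVec (fun i => if i = k then p else q) := by
  ext i
  simp only [planePoint, latticeVec]
  split_ifs <;> rfl

theorem measurePreserving_planePoint (k : Fin 2) :
    MeasurePreserving (fun p : ℝ × ℝ => planePoint k p.1 p.2) := by
  have h0 : MeasurePreserving (fun p : ℝ × ℝ => planePoint 0 p.1 p.2) := by
    have h := (PiLp.volume_preserving_toLp (Fin 2)).comp (volume_preserving_finTwoArrow ℝ).symm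
    refine (congrArg (MeasurePreserving · volume volume) (funext fun p => ?_)).mp h
    ext i
    fin_cases i <;> simp [planePoint]
  fin_cases k
  · exact h0
  · have h1 : MeasurePreserving (Prod.swap : ℝ × ℝ → ℝ × ℝ) volume volume :=
      Measure.measurePreserving_swap
    refine (congrArg (MeasurePreserving · volume volume) (funext fun p => ?_)).mp (h0.comp h1)
    ext i
    fin_cases i <;> simp [planePoint]

theorem measurable_planePoint (k : Fin 2) : Measurable (fun p : ℝ × ℝ => planePoint k p.1 p.2) :=
  (measurePreserving_planePoint k).measurable

theorem continuous_planePoint (k : Fin 2) : Continuous (fun p : ℝ × ℝ => planePoint k p.1 p.2) := by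
  unfold planePoint
  refine (PiLp.continuous_toLp 2 _).comp (continuous_pi fun i => ?_)
  split_ifs <;> fun_prop

theorem setLIntegral_eq_iterated (k : Fin 2) {A B : Set ℝ} {S : Set Plane}
    (hS : MeasurableSet S) (hAB : ∀ x y, planePoint k x y ∈ S ↔ x ∈ A ∧ y ∈ B)
    {F : Plane → ENNReal} (hF : Measurable F) :
    ∫⁻ z in S, F z = ∫⁻ x in A, ∫⁻ y in B, F (planePoint k x y) := by
  rw [← (measurePreserving_planePoint k).setLIntegral_comp_preimage hS hF]
  have : (fun p : ℝ × ℝ => planePoint k p.1 p.2) ⁻¹' S = A ×ˢ B := by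
    ext p
    simp [hAB]
  rw [this, Measure.volume_eq_prod, ← Measure.prod_restrict, lintegral_prod]
  exact (hF.comp (measurable_planePoint k)).aemeasurable

theorem measurableSet_unitCell : MeasurableSet unitCell := by
  have : unitCell = ⋂ i : Fin 2, (fun x : Plane => x i) ⁻¹' Set.Ioo (0 : ℝ) 1 := by
    ext; simp [unitCell]
  rw [this]
  exact MeasurableSet.iInter fun i => (by fun_prop : Measurable fun x : Plane => x i) measurableSet_Ioo

theorem planePoint_mem_unitCell (k : Fin 2) (x y : ℝ) :
    planePoint k x y ∈ unitCell ↔ x ∈ Set.Ioo (0 : ℝ) 1 ∧ y ∈ Set.Ioo (0 : ℝ) 1 := by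
  fin_cases k <;> simp [unitCell, planePoint, Fin.forall_fin_two, and_comm]

theorem lintegral_unitCell (k : Fin 2) {F : Plane → ENNReal} (hF : Measurable F) :
    ∫⁻ z in unitCell, F z =
      ∫⁻ x in Set.Ioo (0 : ℝ) 1, ∫⁻ y in Set.Ioo (0 : ℝ) 1, F (planePoint k x y) :=
  setLIntegral_eq_iterated k measurableSet_unitCell (planePoint_mem_unitCell k) hF

theorem volume_unitCell : volume unitCell = 1 := by
  have := lintegral_unitCell 0 (F := fun _ => 1) measurable_const
  simpa using this

instance isProbabilityMeasure_unitCell : IsProbabilityMeasure (volume.restrict unitCell) :=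
  ⟨by simp [volume_unitCell]⟩

/-- Both intervals are fundamental domains for the translations by ℤ. -/
theorem Function.Periodic.setLIntegral_Ioc {G : ℝ → ENNReal} (hG : Function.Periodic G 1) (s t : ℝ) :
    ∫⁻ x in Set.Ioc s (s + 1), G x = ∫⁻ x in Set.Ioc t (t + 1), G x := by
  refine (isAddFundamentalDomain_Ioc one_pos s).setLIntegral_eq (isAddFundamentalDomain_Ioc one_pos t)
    G ?_
  rintro ⟨g, hg⟩ x
  obtain ⟨m, rfl⟩ := AddSubgroup.mem_zmultiples_iff.1 hg
  have := hG.zsmul m x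
  rw [← this]
  congr 1
  rw [add_comm]
  rfl

theorem Function.Periodic.setLIntegral_Ioc_eq_Ioo {G : ℝ → ENNReal} (hG : Function.Periodic G 1)
    (s : ℝ) : ∫⁻ x in Set.Ioc s (s + 1), G x = ∫⁻ x in Set.Ioo (0 : ℝ) 1, G x := by
  rw [hG.setLIntegral_Ioc s 0, zero_add, setLIntegral_congr Ioo_ae_eq_Ioc]

/-! ### Cauchy–Schwarz, oscillation along curves, and the Poincaré inequality -/

theorem sq_lintegral_le {α : Type*} [MeasurableSpace α] (μ : Measure α) {f : α → ENNReal}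
    (hf : AEMeasurable f μ) : (∫⁻ x, f x ∂μ) ^ 2 ≤ μ Set.univ * ∫⁻ x, f x ^ 2 ∂μ := by
  have h := ENNReal.lintegral_mul_le_Lp_mul_Lq μ Real.HolderConjugate.two_two hf
    (aemeasurable_const (b := (1 : ENNReal)))
  simp only [Pi.mul_apply, mul_one, ENNReal.one_rpow, lintegral_const, one_mul] at h
  have h2 := ENNReal.pow_le_pow_left (n := 2) h
  have hroot : ∀ z : ENNReal, (z ^ (1 / 2 : ℝ)) ^ 2 = z := fun z => by
    rw [← ENNReal.rpow_natCast, ← ENNReal.rpow_mul]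
    simp
  rw [mul_pow, hroot, hroot, mul_comm] at h2
  simpa using h2

theorem enorm_add_sq_le {E : Type*} [SeminormedAddCommGroup E] (x y : E) :
    ‖x + y‖ₑ ^ 2 ≤ 2 * (‖x‖ₑ ^ 2 + ‖y‖ₑ ^ 2) := by
  have h : ‖x + y‖ ^ 2 ≤ 2 * (‖x‖ ^ 2 + ‖y‖ ^ 2) := by
    nlinarith [norm_add_le x y, norm_nonneg (x + y), sq_nonneg (‖x‖ - ‖y‖)]
  have := ENNReal.ofReal_le_ofReal h
  rw [ENNReal.ofReal_mul (by norm_num), ENNReal.ofReal_add (by positivity) (by positivity),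
    ENNReal.ofReal_pow (norm_nonneg _), ENNReal.ofReal_pow (norm_nonneg _),
    ENNReal.ofReal_pow (norm_nonneg _)] at this
  simpa using this

theorem norm_gradient {φ : Plane → ℝ} (x : Plane) : ‖gradient φ x‖ = ‖fderiv ℝ φ x‖ :=
  (InnerProductSpace.toDual ℝ Plane).symm.norm_map _

theorem continuous_gradient {φ : Plane → ℝ} (hφ : ContDiff ℝ ∞ φ) : Continuous (gradient φ) :=
  (InnerProductSpace.toDual ℝ Plane).symm.continuous.comp (hφ.continuous_fderiv (by simp))

/-- Fundamental theorem of calculus along `c`. The bound uses the whole parameter interval, so it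
does not depend on the two points; it serves for coordinate segments (`R = 1`) and for circles (`R`
the radius). -/
theorem enorm_sub_le_lintegral_gradient {φ : Plane → ℝ} (hφ : ContDiff ℝ ∞ φ) {c : ℝ → Plane}
    (hc : ContDiff ℝ 1 c) {R : ℝ} (hR : ∀ t, ‖deriv c t‖ ≤ R) {a b s t : ℝ}
    (hs : s ∈ Set.Icc a b) (ht : t ∈ Set.Icc a b) :
    ‖φ (c s) - φ (c t)‖ₑ ≤ ENNReal.ofReal R * ∫⁻ u in Set.Ioo a b, ‖gradient φ (c u)‖ₑ := by
  wlog hst : t ≤ s generalizing s t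
  · rw [enorm_sub_rev]
    exact this ht hs (le_of_not_ge hst)
  have hcd : ContDiff ℝ 1 (fun u => φ (c u)) := (hφ.of_le (by simp)).comp hc
  refine (enorm_sub_le_lintegral_deriv_of_contDiffOn_Icc hcd.contDiffOn hst).trans ?_
  rw [← lintegral_const_mul _ (by
    exact ((continuous_gradient hφ).comp hc.continuous).enorm.measurable),
    ← setLIntegral_congr Ioo_ae_eq_Icc]
  refine (lintegral_mono_set (Set.Ioo_subset_Ioo ht.1 hs.2)).trans
    (lintegral_mono fun u => ?_)
  have h1 : HasDerivAt (fun u => φ (c u)) (fderiv ℝ φ (c u) (deriv c u)) u :=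
    ((hφ.differentiable (by simp)) (c u)).hasFDerivAt.comp_hasDerivAt u
      (hc.differentiable (by simp) u).hasDerivAt
  rw [h1.deriv, ← ofReal_norm, ← ofReal_norm, ← ENNReal.ofReal_mul ((norm_nonneg _).trans (hR u))]
  refine ENNReal.ofReal_le_ofReal ?_
  rw [norm_gradient, mul_comm]
  exact (ContinuousLinearMap.le_opNorm _ _).trans
    (mul_le_mul_of_nonneg_left (hR u) (norm_nonneg _))

theorem planePoint_eq_add_smul (k : Fin 2) (x y : ℝ) :
    planePoint k x y = planePoint k x 0 + y • planePoint k 0 1 := by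
  ext i
  simp only [planePoint, PiLp.add_apply, PiLp.smul_apply]
  split_ifs <;> simp

theorem norm_planePoint_zero_one (k : Fin 2) : ‖planePoint k 0 1‖ = 1 := by
  fin_cases k <;> simp [planePoint, EuclideanSpace.norm_eq]

theorem planePoint_swap (k : Fin 2) (x y : ℝ) : planePoint (1 - k) x y = planePoint k y x := by
  ext i
  fin_cases k <;> fin_cases i <;> simp [planePoint]

/-- The oscillation of a function on a coordinate segment of unit length is bounded by the
integral of the gradient. -/
theorem enorm_sub_planePoint_le {φ : Plane → ℝ} (hφ : ContDiff ℝ ∞ φ) (k : Fin 2) (x : ℝ)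
    {y y' : ℝ} (hy : y ∈ Set.Icc (0 : ℝ) 1) (hy' : y' ∈ Set.Icc (0 : ℝ) 1) :
    ‖φ (planePoint k x y) - φ (planePoint k x y')‖ₑ ^ 2 ≤
      ∫⁻ t in Set.Ioo (0 : ℝ) 1, ‖gradient φ (planePoint k x t)‖ₑ ^ 2 := by
  have hfun : (fun t => planePoint k x t) = fun t => planePoint k x 0 + t • planePoint k 0 1 :=
    funext (planePoint_eq_add_smul k x)
  have hc : ContDiff ℝ 1 (fun t => planePoint k x t) := by
    rw [hfun]
    fun_prop
  have hd : ∀ t, ‖deriv (fun t => planePoint k x t) t‖ ≤ 1 := fun t => by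
    have : HasDerivAt (fun t => planePoint k x t) (planePoint k 0 1) t := by
      rw [hfun]
      simpa using ((hasDerivAt_id t).smul_const (planePoint k 0 1)).const_add (planePoint k x 0)
    rw [this.deriv, norm_planePoint_zero_one]
  have h := enorm_sub_le_lintegral_gradient hφ hc hd hy hy'
  rw [ENNReal.ofReal_one, one_mul] at h
  refine (ENNReal.pow_le_pow_left h).trans ?_
  refine (sq_lintegral_le _ (by
    exact ((continuous_gradient hφ).comp hc.continuous).enorm.measurable.aemeasurable)).trans ?_
  simp

/-- The Poincaré inequality on the unit cell. -/
theorem lintegral_sub_mean_sq_le {φ : Plane → ℝ} (hφ : ContDiff ℝ ∞ φ)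
    (hint : Integrable φ (volume.restrict unitCell)) :
    ∫⁻ z in unitCell, ‖φ z - ∫ y in unitCell, φ y‖ₑ ^ 2 ≤
      4 * ∫⁻ z in unitCell, ‖gradient φ z‖ₑ ^ 2 := by
  have hG : Measurable fun z => ‖gradient φ z‖ₑ ^ 2 :=
    ((continuous_gradient hφ).enorm.measurable).pow_const 2
  have hGk : ∀ k, Measurable fun p : ℝ × ℝ => ‖gradient φ (planePoint k p.1 p.2)‖ₑ ^ 2 :=
    fun k => hG.comp (measurable_planePoint k)
  set D := ∫⁻ z in unitCell, ‖gradient φ z‖ₑ ^ 2 with hD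
  -- The cell has measure one, so subtracting the mean is averaging the differences φ z - φ y, and
  -- Cauchy–Schwarz applies.
  have key : ∀ z, ‖φ z - ∫ y in unitCell, φ y‖ₑ ^ 2 ≤
      ∫⁻ y in unitCell, ‖φ z - φ y‖ₑ ^ 2 := fun z => by
    have h1 : φ z - ∫ y in unitCell, φ y = ∫ y in unitCell, (φ z - φ y) := by
      rw [integral_sub (integrable_const _) hint]
      simp
    rw [h1]
    refine (ENNReal.pow_le_pow_left (enorm_integral_le_lintegral_enorm _)).trans ?_
    refine (sq_lintegral_le _ ?_).trans ?_
    · exact (continuous_const.sub hφ.continuous).enorm.measurable.aemeasurable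
    · simp
  -- Two points of the cell are joined by a vertical and then a horizontal segment. Each segment
  -- contributes a slice integral that depends on one coordinate only.
  have hpq : ∀ x ∈ Set.Ioo (0 : ℝ) 1, ∀ y ∈ Set.Ioo (0 : ℝ) 1, ∀ x' ∈ Set.Ioo (0 : ℝ) 1,
      ∀ y' ∈ Set.Ioo (0 : ℝ) 1, ‖φ (planePoint 0 x y) - φ (planePoint 0 x' y')‖ₑ ^ 2 ≤
      2 * ((∫⁻ t in Set.Ioo (0 : ℝ) 1, ‖gradient φ (planePoint 0 x t)‖ₑ ^ 2) +
        ∫⁻ t in Set.Ioo (0 : ℝ) 1, ‖gradient φ (planePoint 1 y' t)‖ₑ ^ 2) := by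
    intro x hx y hy x' hx' y' hy'
    have h1 := enorm_sub_planePoint_le hφ 0 x (Set.Ioo_subset_Icc_self hy)
      (Set.Ioo_subset_Icc_self hy')
    have h2 := enorm_sub_planePoint_le hφ 1 y' (Set.Ioo_subset_Icc_self hx)
      (Set.Ioo_subset_Icc_self hx')
    have hs : ∀ u, planePoint 1 y' u = planePoint 0 u y' := fun u => planePoint_swap 0 y' u
    rw [hs, hs] at h2
    have h3 := enorm_add_sq_le (φ (planePoint 0 x y) - φ (planePoint 0 x y'))
      (φ (planePoint 0 x y') - φ (planePoint 0 x' y'))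
    rw [sub_add_sub_cancel] at h3
    exact h3.trans (by gcongr)
  have hmeas : ∀ z, Measurable fun y => ‖φ z - φ y‖ₑ ^ 2 := fun z =>
    (continuous_const.sub hφ.continuous).enorm.measurable.pow_const 2
  have hE0 : (∫⁻ x in Set.Ioo (0 : ℝ) 1, ∫⁻ t in Set.Ioo (0 : ℝ) 1,
      ‖gradient φ (planePoint 0 x t)‖ₑ ^ 2) = D := (lintegral_unitCell 0 hG).symm
  have hE1 : (∫⁻ x in Set.Ioo (0 : ℝ) 1, ∫⁻ t in Set.Ioo (0 : ℝ) 1,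
      ‖gradient φ (planePoint 1 x t)‖ₑ ^ 2) = D := (lintegral_unitCell 1 hG).symm
  have hz : ∀ x ∈ Set.Ioo (0 : ℝ) 1, ∀ y ∈ Set.Ioo (0 : ℝ) 1,
      (∫⁻ q in unitCell, ‖φ (planePoint 0 x y) - φ q‖ₑ ^ 2) ≤
      2 * ((∫⁻ t in Set.Ioo (0 : ℝ) 1, ‖gradient φ (planePoint 0 x t)‖ₑ ^ 2) + D) := by
    intro x hx y hy
    rw [lintegral_unitCell 0 (hmeas _)]
    calc _ ≤ ∫⁻ x' in Set.Ioo (0 : ℝ) 1, ∫⁻ y' in Set.Ioo (0 : ℝ) 1,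
          2 * ((∫⁻ t in Set.Ioo (0 : ℝ) 1, ‖gradient φ (planePoint 0 x t)‖ₑ ^ 2) +
        ∫⁻ t in Set.Ioo (0 : ℝ) 1, ‖gradient φ (planePoint 1 y' t)‖ₑ ^ 2) :=
          setLIntegral_mono' measurableSet_Ioo fun x' hx' =>
            setLIntegral_mono' measurableSet_Ioo fun y' hy' => hpq x hx y hy x' hx' y' hy'
      _ = _ := by
        rw [lintegral_const_mul _ (by
          exact measurable_const.add ((hGk 1).lintegral_prod_right')),
          lintegral_add_left measurable_const, hE1]
        simp
  calc _ ≤ ∫⁻ z in unitCell, ∫⁻ q in unitCell, ‖φ z - φ q‖ₑ ^ 2 := lintegral_mono key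
    _ = ∫⁻ x in Set.Ioo (0 : ℝ) 1, ∫⁻ y in Set.Ioo (0 : ℝ) 1,
        ∫⁻ q in unitCell, ‖φ (planePoint 0 x y) - φ q‖ₑ ^ 2 := by
      refine lintegral_unitCell 0 (F := fun z => ∫⁻ q in unitCell, ‖φ z - φ q‖ₑ ^ 2) ?_
      refine Measurable.lintegral_prod_right' (f := fun p : Plane × Plane => ‖φ p.1 - φ p.2‖ₑ ^ 2) ?_
      exact ((hφ.continuous.comp continuous_fst).sub
        (hφ.continuous.comp continuous_snd)).enorm.measurable.pow_const 2
    _ ≤ ∫⁻ x in Set.Ioo (0 : ℝ) 1, ∫⁻ _ in Set.Ioo (0 : ℝ) 1,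
        2 * ((∫⁻ t in Set.Ioo (0 : ℝ) 1, ‖gradient φ (planePoint 0 x t)‖ₑ ^ 2) + D) :=
      setLIntegral_mono' measurableSet_Ioo fun x hx =>
        setLIntegral_mono' measurableSet_Ioo fun y hy => hz x hx y hy
    _ = 4 * D := by
      simp only [lintegral_const, MeasurableSet.univ, Measure.restrict_apply, Set.univ_inter,
        Real.volume_Ioo, sub_zero, ENNReal.ofReal_one, mul_one]
      rw [lintegral_const_mul _ (by
          exact ((hGk 0).lintegral_prod_right').add measurable_const),
          lintegral_add_right _ measurable_const, hE0]
      simp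
      ring

/-! ### The trace inequality on curves in the torus -/

theorem gradient_add_latticeVec {φ : Plane → ℝ} (hp : IsOnePeriodic φ) (m : Fin 2 → ℤ) (x : Plane) :
    gradient φ (x + latticeVec m) = gradient φ x := by
  unfold gradient
  rw [← fderiv_comp_add_right]
  simp_rw [hp m]

theorem planePoint_fract (k : Fin 2) (x y : ℝ) : planePoint k x y =
    planePoint k x (Int.fract y) + latticeVec (fun i => if i = k then 0 else ⌊y⌋) := by
  rw [← planePoint_int, ← planePoint_add]
  simp

/-- The `H¹` energy density of a function, integrated over a coordinate segment of unit length. -/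
noncomputable def sliceEnergy (φ : Plane → ℝ) (k : Fin 2) (x : ℝ) : ENNReal :=
  ∫⁻ t in Set.Ioo (0 : ℝ) 1,
    (‖φ (planePoint k x t)‖ₑ ^ 2 + ‖gradient φ (planePoint k x t)‖ₑ ^ 2)

theorem measurable_energyDensity {φ : Plane → ℝ} (hφ : ContDiff ℝ ∞ φ) :
    Measurable fun z => ‖φ z‖ₑ ^ 2 + ‖gradient φ z‖ₑ ^ 2 :=
  (hφ.continuous.enorm.measurable.pow_const 2).add
    ((continuous_gradient hφ).enorm.measurable.pow_const 2)

theorem sliceEnergy_periodic {φ : Plane → ℝ} (hp : IsOnePeriodic φ) (k : Fin 2) :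
    Function.Periodic (sliceEnergy φ k) 1 := fun x => by
  unfold sliceEnergy
  refine lintegral_congr fun t => ?_
  have h : planePoint k (x + 1) t =
      planePoint k x t + latticeVec (fun i => if i = k then 1 else 0) := by
    rw [← planePoint_int, ← planePoint_add]
    simp
  rw [h, hp, gradient_add_latticeVec hp]

/-- One-dimensional Sobolev embedding on a slice: compare the value at one point with the value at
t, whose difference is controlled by the gradient, and average over t. Periodicity brings the point
into the unit segment. -/
theorem enorm_sq_le_sliceEnergy {φ : Plane → ℝ} (hφ : ContDiff ℝ ∞ φ) (hp : IsOnePeriodic φ)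
    (k : Fin 2) (x y : ℝ) : ‖φ (planePoint k x y)‖ₑ ^ 2 ≤ 2 * sliceEnergy φ k x := by
  rw [planePoint_fract, hp]
  have hy : Int.fract y ∈ Set.Icc (0 : ℝ) 1 := ⟨Int.fract_nonneg y, (Int.fract_lt_one y).le⟩
  generalize Int.fract y = u at hy
  have hcont : Continuous fun t => planePoint k x t :=
    (continuous_planePoint k).comp (continuous_const.prodMk continuous_id)
  have h1 : ∀ t ∈ Set.Ioo (0 : ℝ) 1, ‖φ (planePoint k x u)‖ₑ ^ 2 ≤
      2 * (‖φ (planePoint k x t)‖ₑ ^ 2 +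
        ∫⁻ t in Set.Ioo (0 : ℝ) 1, ‖gradient φ (planePoint k x t)‖ₑ ^ 2) := fun t ht => by
    have h2 := enorm_add_sq_le (φ (planePoint k x t)) (φ (planePoint k x u) - φ (planePoint k x t))
    rw [add_sub_cancel] at h2
    refine h2.trans ?_
    gcongr
    exact enorm_sub_planePoint_le hφ k x hy (Set.Ioo_subset_Icc_self ht)
  have hm : Measurable fun t => ‖φ (planePoint k x t)‖ₑ ^ 2 :=
    (hφ.continuous.comp hcont).enorm.measurable.pow_const 2
  have h3 := setLIntegral_mono' (μ := volume) measurableSet_Ioo h1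
  rw [lintegral_const_mul _ (by exact hm.add measurable_const), lintegral_add_left hm] at h3
  unfold sliceEnergy
  rw [lintegral_add_left hm]
  simpa using h3

theorem lintegral_sliceEnergy {φ : Plane → ℝ} (hφ : ContDiff ℝ ∞ φ) (k : Fin 2) :
    ∫⁻ x in Set.Ioo (0 : ℝ) 1, sliceEnergy φ k x =
      ∫⁻ z in unitCell, (‖φ z‖ₑ ^ 2 + ‖gradient φ z‖ₑ ^ 2) :=
  (lintegral_unitCell k (measurable_energyDensity hφ)).symm

theorem injOn_of_hasDerivWithinAt_ne_zero {f f' : ℝ → ℝ} {I : Set ℝ} (hI : Convex ℝ I)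
    (hf : ∀ s ∈ I, HasDerivWithinAt f (f' s) I s)
    (hpos : (∀ s ∈ I, 0 < f' s) ∨ ∀ s ∈ I, f' s < 0) : Set.InjOn f I := by
  have hcont : ContinuousOn f I := fun s hs => (hf s hs).continuousWithinAt
  have hder : ∀ s ∈ interior I, deriv f s = f' s := fun s hs =>
    ((hf s (interior_subset hs)).hasDerivAt (mem_interior_iff_mem_nhds.1 hs)).deriv
  rcases hpos with h | h
  · exact (strictMonoOn_of_deriv_pos hI hcont fun s hs => by
      rw [hder s hs]; exact h s (interior_subset hs)).injOn
  · exact (strictAntiOn_of_deriv_neg hI hcont fun s hs => by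
      rw [hder s hs]; exact h s (interior_subset hs)).injOn

/-- The trace inequality near a point of a curve. -/
theorem exists_local_trace_bound {γ τ : ℝ → Plane} {I : Set ℝ} (hI : Convex ℝ I)
    (hIm : MeasurableSet I)
    (hγ : ∀ s ∈ I, HasDerivWithinAt γ (τ s) I s) (hτ : ContinuousOn τ I) {s₀ : ℝ} (hs₀ : s₀ ∈ I)
    (hne : τ s₀ ≠ 0) : ∃ U ∈ 𝓝[I] s₀, ∃ C : NNReal, ∀ φ : Plane → ℝ, ContDiff ℝ ∞ φ →
      IsOnePeriodic φ → ∫⁻ s in U, ‖φ (γ s)‖ₑ ^ 2 ≤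
        C * ∫⁻ z in unitCell, (‖φ z‖ₑ ^ 2 + ‖gradient φ z‖ₑ ^ 2) := by
  -- Near `s₀` the coordinate x_k is a valid parameter of the curve. In this parameter the squared
  -- trace is bounded by the energy of the slice through the point, and integrating over the slices
  -- gives the energy of the cell.
  obtain ⟨k, hk⟩ : ∃ k, τ s₀ k ≠ 0 := by
    by_contra! h
    exact hne (by ext i; simpa using h i)
  have happ : ContinuousOn (fun s => τ s k) I :=
    (by fun_prop : Continuous fun z : Plane => z k).comp_continuousOn hτ
  have hγk : ∀ s ∈ I, HasDerivWithinAt (fun s => γ s k) (τ s k) I s := fun s hs =>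
    (EuclideanSpace.proj k : Plane →L[ℝ] ℝ).hasFDerivAt.comp_hasDerivWithinAt s (hγ s hs)
  set c := |τ s₀ k| / 2 with hc
  have hcpos : 0 < c := by positivity
  have e1 : ∀ᶠ s in 𝓝[I] s₀, |τ s k - τ s₀ k| < c := by
    have := (happ s₀ hs₀).eventually (Metric.ball_mem_nhds _ hcpos)
    simpa [Real.dist_eq] using this
  -- This keeps the range of x_k inside one period, so no slice of the torus is counted twice.
  have e2 : ∀ᶠ s in 𝓝[I] s₀, |γ s k - γ s₀ k| < 1 / 2 := by
    have := (hγk s₀ hs₀).continuousWithinAt.eventually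
      (Metric.ball_mem_nhds _ (by norm_num : (0 : ℝ) < 1 / 2))
    simpa [Real.dist_eq] using this
  obtain ⟨δ, hδ, hball⟩ := Metric.mem_nhdsWithin_iff.1 (e1.and e2)
  set U := Metric.ball s₀ δ ∩ I with hU
  have hUm : MeasurableSet U := Metric.isOpen_ball.measurableSet.inter hIm
  have hUI : U ⊆ I := Set.inter_subset_right
  have hU1 : ∀ s ∈ U, |τ s k - τ s₀ k| < c := fun s hs => (hball hs).1
  have hU2 : ∀ s ∈ U, |γ s k - γ s₀ k| < 1 / 2 := fun s hs => (hball hs).2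
  have hd : ∀ s ∈ U, HasDerivWithinAt (fun s => γ s k) (τ s k) U s := fun s hs =>
    (hγk s (hUI hs)).mono hUI
  have hsign : (∀ s ∈ U, 0 < τ s k) ∨ ∀ s ∈ U, τ s k < 0 := by
    rcases lt_or_gt_of_ne hk with h | h
    · right
      intro s hs
      have := abs_lt.1 (hU1 s hs)
      rw [hc, abs_of_neg h] at this
      linarith [this.2]
    · left
      intro s hs
      have := abs_lt.1 (hU1 s hs)
      rw [hc, abs_of_pos h] at this
      linarith [this.1]
  have hinj := injOn_of_hasDerivWithinAt_ne_zero ((convex_ball s₀ δ).inter hI) hd hsign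
  have hlow : ∀ s ∈ U, c ≤ |τ s k| := fun s hs => by
    have h1 := hU1 s hs
    have h2 := abs_sub_abs_le_abs_sub (τ s₀ k) (τ s k)
    rw [abs_sub_comm] at h2
    have : |τ s₀ k| = 2 * c := by rw [hc]; ring
    linarith
  -- The factor 2 comes from the bound on a slice, and 1 / c from inserting the Jacobian |τ_k| ≥ c
  -- of the change of variables.
  refine ⟨U, Filter.inter_mem (mem_nhdsWithin_of_mem_nhds (Metric.ball_mem_nhds _ hδ))
    self_mem_nhdsWithin, 2 * (Real.toNNReal c)⁻¹, fun φ hφ hp => ?_⟩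
  have hcn : (Real.toNNReal c) ≠ 0 := by simpa using hcpos
  have hpt : ∀ s ∈ U, ‖φ (γ s)‖ₑ ^ 2 ≤ ((2 * (Real.toNNReal c)⁻¹ : NNReal) : ENNReal) *
      (ENNReal.ofReal |τ s k| * sliceEnergy φ k (γ s k)) := fun s hs => by
    have h1 := enorm_sq_le_sliceEnergy hφ hp k (γ s k) (γ s (1 - k))
    rw [planePoint_coords] at h1
    refine h1.trans ?_
    have h2 : (1 : ENNReal) ≤ (((Real.toNNReal c)⁻¹ : NNReal) : ENNReal) * ENNReal.ofReal |τ s k| := by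
      calc (1 : ENNReal) = (((Real.toNNReal c)⁻¹ : NNReal) : ENNReal) * ENNReal.ofReal c := by
            rw [ENNReal.ofReal, ← ENNReal.coe_mul, inv_mul_cancel₀ hcn, ENNReal.coe_one]
        _ ≤ _ := by gcongr; exact hlow s hs
    calc 2 * sliceEnergy φ k (γ s k) = 2 * (1 * sliceEnergy φ k (γ s k)) := by rw [one_mul]
      _ ≤ 2 * (((((Real.toNNReal c)⁻¹ : NNReal) : ENNReal) * ENNReal.ofReal |τ s k|) *
          sliceEnergy φ k (γ s k)) := by gcongr
      _ = _ := by push_cast; ring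
  calc ∫⁻ s in U, ‖φ (γ s)‖ₑ ^ 2
      ≤ ∫⁻ s in U, ((2 * (Real.toNNReal c)⁻¹ : NNReal) : ENNReal) *
        (ENNReal.ofReal |τ s k| * sliceEnergy φ k (γ s k)) := setLIntegral_mono' hUm hpt
    _ = ((2 * (Real.toNNReal c)⁻¹ : NNReal) : ENNReal) *
        ∫⁻ s in U, ENNReal.ofReal |τ s k| * sliceEnergy φ k (γ s k) :=
      lintegral_const_mul' _ _ ENNReal.coe_ne_top
    _ = ((2 * (Real.toNNReal c)⁻¹ : NNReal) : ENNReal) *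
        ∫⁻ x in (fun s => γ s k) '' U, sliceEnergy φ k x := by
      rw [lintegral_image_eq_lintegral_abs_deriv_mul hUm hd hinj]
    _ ≤ ((2 * (Real.toNNReal c)⁻¹ : NNReal) : ENNReal) *
        ∫⁻ x in Set.Ioc (γ s₀ k - 1 / 2) (γ s₀ k - 1 / 2 + 1), sliceEnergy φ k x := by
      gcongr
      rintro _ ⟨s, hs, rfl⟩
      have := abs_lt.1 (hU2 s hs)
      constructor
      · linarith [this.1]
      · linarith [this.2]
    _ = _ := by
      rw [(sliceEnergy_periodic hp k).setLIntegral_Ioc_eq_Ioo, lintegral_sliceEnergy hφ]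

/-- The trace inequality on a regular curve. -/
theorem exists_trace_bound {γ τ : ℝ → Plane} {L : ℝ}
    (hγ : ∀ s ∈ Set.Icc 0 L, HasDerivWithinAt γ (τ s) (Set.Icc 0 L) s)
    (hτ : ContinuousOn τ (Set.Icc 0 L)) (hne : ∀ s ∈ Set.Icc 0 L, τ s ≠ 0) :
    ∃ C : NNReal, ∀ φ : Plane → ℝ, ContDiff ℝ ∞ φ → IsOnePeriodic φ →
      ∫⁻ s in Set.Icc 0 L, ‖φ (γ s)‖ₑ ^ 2 ≤
        C * ∫⁻ z in unitCell, (‖φ z‖ₑ ^ 2 + ‖gradient φ z‖ₑ ^ 2) := by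
  refine (isCompact_Icc (a := (0 : ℝ)) (b := L)).induction_on (p := fun S => ∃ C : NNReal, ∀ φ : Plane → ℝ,
    ContDiff ℝ ∞ φ → IsOnePeriodic φ → ∫⁻ s in S, ‖φ (γ s)‖ₑ ^ 2 ≤
        C * ∫⁻ z in unitCell, (‖φ z‖ₑ ^ 2 + ‖gradient φ z‖ₑ ^ 2)) ⟨0, by simp⟩ ?_ ?_ ?_
  · rintro S T hST ⟨C, hC⟩
    exact ⟨C, fun φ h1 h2 => (lintegral_mono_set hST).trans (hC φ h1 h2)⟩
  · rintro S T ⟨C, hC⟩ ⟨D, hD⟩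
    refine ⟨C + D, fun φ h1 h2 => (lintegral_union_le _ S T).trans ?_⟩
    rw [ENNReal.coe_add, add_mul]
    exact add_le_add (hC φ h1 h2) (hD φ h1 h2)
  · intro s hs
    exact exists_local_trace_bound (convex_Icc 0 L) measurableSet_Icc hγ hτ hs (hne s hs)

/-! ### Cell functions as a closed subspace of a product of L² spaces -/

/-- Lebesgue measure on the unit cell. -/
noncomputable abbrev cellMeasure : Measure Plane := volume.restrict unitCell

/-- The arc-length measure on the `i`-th curve. -/
noncomputable abbrev PeriodicPattern.arcMeasure {n : ℕ} (P : PeriodicPattern n) (i : Fin n) :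
    Measure ℝ := volume.restrict (Set.Icc 0 (P.length i))

namespace PeriodicPattern

variable {n : ℕ} (P : PeriodicPattern n)

theorem hasDerivWithinAt_curve (i : Fin n) {s : ℝ} (hs : s ∈ Set.Icc 0 (P.length i)) :
    HasDerivWithinAt (P.curve i) (P.tangent i s) (Set.Icc 0 (P.length i)) s :=
  ((P.contDiffOn_curve i).differentiableOn (by simp) s hs).hasDerivWithinAt

theorem continuousOn_tangent (i : Fin n) : ContinuousOn (P.tangent i) (Set.Icc 0 (P.length i)) :=
  (P.contDiffOn_curve i).continuousOn_derivWithin (uniqueDiffOn_Icc (P.length_pos i)) (by simp)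

theorem continuousOn_curve (i : Fin n) : ContinuousOn (P.curve i) (Set.Icc 0 (P.length i)) :=
  (P.contDiffOn_curve i).continuousOn

theorem norm_tangent (i : Fin n) {s : ℝ} (hs : s ∈ Set.Icc 0 (P.length i)) :
    ‖P.tangent i s‖ = 1 := P.unit_speed i s hs

end PeriodicPattern

theorem ContinuousOn.memLp_restrict_of_isCompact {α E : Type*} [TopologicalSpace α]
    [MeasurableSpace α] [OpensMeasurableSpace α] [NormedAddCommGroup E] {μ : Measure α}
    [IsFiniteMeasureOnCompacts μ] [SecondCountableTopologyEither α E]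
    {f : α → E} {K : Set α} (hf : ContinuousOn f K) (hK : IsCompact K) (hKm : MeasurableSet K)
    (p : ENNReal) : MemLp f p (μ.restrict K) := by
  have : IsFiniteMeasure (μ.restrict K) := ⟨by simpa using hK.measure_lt_top⟩
  obtain ⟨C, hC⟩ := hK.exists_bound_of_continuousOn hf
  exact MemLp.of_bound (hf.aestronglyMeasurable hKm) C
    ((ae_restrict_iff' hKm).2 (Eventually.of_forall hC))

theorem unitCell_subset_closedBall : unitCell ⊆ Metric.closedBall 0 2 := fun x hx => by
  rw [mem_closedBall_zero_iff, EuclideanSpace.norm_eq, Fin.sum_univ_two]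
  have h0 := hx 0
  have h1 := hx 1
  refine Real.sqrt_le_iff.2 ⟨by norm_num, ?_⟩
  simp only [Real.norm_eq_abs, sq_abs]
  nlinarith [h0.1, h0.2, h1.1, h1.2]

theorem Continuous.memLp_unitCell {E : Type*} [NormedAddCommGroup E] {f : Plane → E}
    (hf : Continuous f) (p : ENNReal) : MemLp f p cellMeasure :=
  (hf.continuousOn.memLp_restrict_of_isCompact (isCompact_closedBall (0 : Plane) 2)
    measurableSet_closedBall p).mono_measure (Measure.restrict_mono unitCell_subset_closedBall le_rfl)

theorem Lp_enorm_sq {α E : Type*} [MeasurableSpace α] [NormedAddCommGroup E] {μ : Measure α}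
    (f : Lp E 2 μ) : ‖f‖ₑ ^ 2 = ∫⁻ x, ‖f x‖ₑ ^ 2 ∂μ := by
  have := eLpNorm_nnreal_pow_eq_lintegral (μ := μ) (f := f) (p := 2) (by norm_num)
  rw [Lp.enorm_def]
  simpa using this

theorem gradient_add_fun {φ ψ : Plane → ℝ} (hφ : Differentiable ℝ φ) (hψ : Differentiable ℝ ψ)
    (x : Plane) : gradient (φ + ψ) x = gradient φ x + gradient ψ x := by
  simp [gradient, fderiv_add (hφ x) (hψ x)]

theorem gradient_const_smul_fun {φ : Plane → ℝ} (hφ : Differentiable ℝ φ) (c : ℝ)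
    (x : Plane) : gradient (c • φ) x = c • gradient φ x := by
  simp [gradient, fderiv_const_smul (hφ x) c]

/-- The mean value over the unit cell. -/
noncomputable def cellMean : Lp ℝ 2 cellMeasure →L[ℝ] ℝ :=
  innerSL ℝ (Lp.constL 2 cellMeasure ℝ (1 : ℝ))

theorem cellMean_apply (u : Lp ℝ 2 cellMeasure) : cellMean u = ∫ x in unitCell, u x := by
  rw [cellMean, innerSL_apply_apply, L2.inner_def]
  refine integral_congr_ae ?_
  filter_upwards [Lp.coeFn_const 2 cellMeasure (1 : ℝ)] with x hx
  change inner ℝ ((Lp.const 2 cellMeasure (1 : ℝ) : Lp ℝ 2 cellMeasure) x) (u x) = u x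
  rw [hx]
  simp

/-- The integral from the initial point, as a map of square integrable functions on `[0, L]`. -/
theorem exists_primitive (L : ℝ) : ∃ V : Lp ℝ 2 (volume.restrict (Set.Icc 0 L)) →L[ℝ]
    Lp ℝ 2 (volume.restrict (Set.Icc 0 L)), ∀ d, V d =ᵐ[volume.restrict (Set.Icc 0 L)]
      fun s => ∫ t in (0 : ℝ)..s, d t := by
  set ν := volume.restrict (Set.Icc 0 L) with hν
  have hint : ∀ d : Lp ℝ 2 ν, IntegrableOn d (Set.Icc 0 L) := fun d =>
    (Lp.memLp d).integrable (by norm_num)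
  have hint' : ∀ d : Lp ℝ 2 ν, ∀ s ∈ Set.Icc 0 L, IntervalIntegrable d volume 0 s :=
    fun d s hs => (intervalIntegrable_iff_integrableOn_Icc_of_le hs.1).2
      ((hint d).mono_set (Set.Icc_subset_Icc_right hs.2))
  have hmem : ∀ d : Lp ℝ 2 ν, MemLp (fun s => ∫ t in (0 : ℝ)..s, d t) 2 ν := fun d => by
    refine ContinuousOn.memLp_restrict_of_isCompact ?_ isCompact_Icc measurableSet_Icc 2
    rcases le_total 0 L with h | h
    · rw [← Set.uIcc_of_le h]
      refine intervalIntegral.continuousOn_primitive_interval ?_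
      rw [Set.uIcc_of_le h]
      exact hint d
    · exact (Set.subsingleton_Icc_of_ge h).continuousOn _
  let V : Lp ℝ 2 ν →ₗ[ℝ] Lp ℝ 2 ν :=
    { toFun := fun d => (hmem d).toLp _
      map_add' := fun d e => by
        rw [← MemLp.toLp_add]
        refine MemLp.toLp_congr _ _ ((ae_restrict_iff' measurableSet_Icc).2
          (Eventually.of_forall fun s hs => ?_))
        simp only [Pi.add_apply]
        rw [← intervalIntegral.integral_add (hint' d s hs) (hint' e s hs)]
        refine intervalIntegral.integral_congr_ae ?_
        have h := (ae_restrict_iff' measurableSet_Icc).1 (Lp.coeFn_add d e)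
        filter_upwards [h] with t ht hts
        rw [Set.uIoc_of_le hs.1] at hts
        exact ht ⟨hts.1.le, hts.2.trans hs.2⟩
      map_smul' := fun c d => by
        rw [RingHom.id_apply, ← MemLp.toLp_const_smul]
        refine MemLp.toLp_congr _ _ ((ae_restrict_iff' measurableSet_Icc).2
          (Eventually.of_forall fun s hs => ?_))
        simp only [Pi.smul_apply]
        rw [← intervalIntegral.integral_smul]
        refine intervalIntegral.integral_congr_ae ?_
        have h := (ae_restrict_iff' measurableSet_Icc).1 (Lp.coeFn_smul c d)
        filter_upwards [h] with t ht hts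
        rw [Set.uIoc_of_le hs.1] at hts
        exact ht ⟨hts.1.le, hts.2.trans hs.2⟩ }
  have hV : ∀ d, V d =ᵐ[ν] fun s => ∫ t in (0 : ℝ)..s, d t := fun d =>
    MemLp.coeFn_toLp (hmem d)
  refine ⟨V.mkContinuous (L.toNNReal) fun d => ?_, hV⟩
  -- Cauchy–Schwarz bounds the squared primitive pointwise by L ‖d‖²; integration over [0, L] gives
  -- the second factor L.
  have h1 : ‖V d‖ₑ ^ 2 ≤ (ENNReal.ofReal L) ^ 2 * ‖d‖ₑ ^ 2 := by
    have hcongr : ∫⁻ s, ‖V d s‖ₑ ^ 2 ∂ν = ∫⁻ s, ‖∫ t in (0 : ℝ)..s, d t‖ₑ ^ 2 ∂ν :=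
      lintegral_congr_ae ((hV d).fun_comp fun y => ‖y‖ₑ ^ 2)
    rw [Lp_enorm_sq, hcongr]
    have h2 : ∀ s ∈ Set.Icc 0 L, ‖∫ t in (0 : ℝ)..s, d t‖ₑ ^ 2 ≤ ENNReal.ofReal L * ‖d‖ₑ ^ 2 := by
      intro s hs
      have h3 : ‖∫ t in (0 : ℝ)..s, d t‖ₑ ≤ ∫⁻ t, ‖d t‖ₑ ∂ν := by
        rw [intervalIntegral.integral_of_le hs.1]
        refine (enorm_integral_le_lintegral_enorm _).trans (lintegral_mono_set ?_)
        exact fun t ht => ⟨ht.1.le, ht.2.trans hs.2⟩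
      refine (ENNReal.pow_le_pow_left h3).trans ((sq_lintegral_le ν
        (Lp.aestronglyMeasurable d).enorm).trans (le_of_eq ?_))
      rw [Lp_enorm_sq]
      simp [hν]
    refine (setLIntegral_mono' measurableSet_Icc h2).trans (le_of_eq ?_)
    simp
    ring
  rw [← mul_pow] at h1
  have h2 := (ENNReal.pow_le_pow_left_iff (by norm_num)).1 h1
  have h3 := ENNReal.toReal_mono (by finiteness) h2
  simpa [ENNReal.toReal_mul, ENNReal.toReal_ofReal', Real.coe_toNNReal'] using h3

theorem memLp_comp_curve {n : ℕ} (P : PeriodicPattern n) {φ : Plane → ℝ} (hφ : Continuous φ)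
    (i : Fin n) : MemLp (fun s => φ (P.curve i s)) 2 (P.arcMeasure i) :=
  (hφ.comp_continuousOn (P.continuousOn_curve i)).memLp_restrict_of_isCompact isCompact_Icc
    measurableSet_Icc 2

namespace PeriodicPattern

variable {n : ℕ} (P : PeriodicPattern n)

/-- Square integrable functions, gradient fields and traces. -/
abbrev TripleSpace : Type :=
  Lp ℝ 2 cellMeasure × Lp Plane 2 cellMeasure × (∀ i, Lp ℝ 2 (P.arcMeasure i))

/-- The triples that consist of a smooth periodic function, its gradient and its traces. -/
noncomputable def smoothTriples : Submodule ℝ P.TripleSpace where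
  carrier := {z | ∃ φ : Plane → ℝ, ContDiff ℝ ∞ φ ∧ IsOnePeriodic φ ∧ z.1 =ᵐ[cellMeasure] φ ∧
    z.2.1 =ᵐ[cellMeasure] gradient φ ∧
    ∀ i, z.2.2 i =ᵐ[P.arcMeasure i] fun s => φ (P.curve i s)}
  zero_mem' := by
    refine ⟨0, contDiff_const, fun m x => rfl, Lp.coeFn_zero _ _ _, ?_, fun i => ?_⟩
    · filter_upwards [Lp.coeFn_zero Plane 2 cellMeasure] with x hx
      change (0 : Lp Plane 2 cellMeasure) x = _
      rw [hx]
      change (0 : Plane) = gradient (Function.const Plane (0 : ℝ)) x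
      rw [gradient_const]
    · exact Lp.coeFn_zero _ _ _
  add_mem' := by
    rintro z z' ⟨φ, h1, h2, h3, h4, h5⟩ ⟨φ', h1', h2', h3', h4', h5'⟩
    refine ⟨φ + φ', h1.add h1', fun m x => ?_, ?_, ?_, fun i => ?_⟩
    · simp [h2 m x, h2' m x]
    · exact (Lp.coeFn_add _ _).trans (h3.add h3')
    · refine (Lp.coeFn_add _ _).trans ?_
      filter_upwards [h4, h4'] with x hx hx'
      rw [Pi.add_apply, hx, hx', gradient_add_fun (h1.differentiable (by simp))
        (h1'.differentiable (by simp))]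
    · exact (Lp.coeFn_add _ _).trans ((h5 i).add (h5' i))
  smul_mem' := by
    rintro c z ⟨φ, h1, h2, h3, h4, h5⟩
    refine ⟨c • φ, h1.const_smul c, fun m x => ?_, ?_, ?_, fun i => ?_⟩
    · simp [h2 m x]
    · exact (Lp.coeFn_smul _ _).trans (h3.const_smul c)
    · refine (Lp.coeFn_smul _ _).trans ?_
      filter_upwards [h4] with x hx
      rw [Pi.smul_apply, hx, gradient_const_smul_fun (h1.differentiable (by simp))]
    · exact (Lp.coeFn_smul _ _).trans ((h5 i).const_smul c)

/-- The triple of a smooth periodic function. -/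
noncomputable def smoothTriple {φ : Plane → ℝ} (hφ : ContDiff ℝ ∞ φ) : P.TripleSpace :=
  ((hφ.continuous.memLp_unitCell 2).toLp φ,
    ((continuous_gradient hφ).memLp_unitCell 2).toLp (gradient φ),
    fun i => (memLp_comp_curve P hφ.continuous i).toLp _)

theorem smoothTriple_fst_ae {φ : Plane → ℝ} (hφ : ContDiff ℝ ∞ φ) :
    (P.smoothTriple hφ).1 =ᵐ[cellMeasure] φ :=
  MemLp.coeFn_toLp (hφ.continuous.memLp_unitCell 2)

theorem smoothTriple_grad_ae {φ : Plane → ℝ} (hφ : ContDiff ℝ ∞ φ) :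
    (P.smoothTriple hφ).2.1 =ᵐ[cellMeasure] gradient φ :=
  MemLp.coeFn_toLp ((continuous_gradient hφ).memLp_unitCell 2)

theorem smoothTriple_trace_ae {φ : Plane → ℝ} (hφ : ContDiff ℝ ∞ φ) (i : Fin n) :
    (P.smoothTriple hφ).2.2 i =ᵐ[P.arcMeasure i] fun s => φ (P.curve i s) :=
  MemLp.coeFn_toLp (memLp_comp_curve P hφ.continuous i)

theorem smoothTriple_mem {φ : Plane → ℝ} (hφ : ContDiff ℝ ∞ φ) (hp : IsOnePeriodic φ) :
    P.smoothTriple hφ ∈ P.smoothTriples :=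
  ⟨φ, hφ, hp, P.smoothTriple_fst_ae hφ, P.smoothTriple_grad_ae hφ, P.smoothTriple_trace_ae hφ⟩

theorem exists_eq_smoothTriple {z : P.TripleSpace} (hz : z ∈ P.smoothTriples) :
    ∃ (φ : Plane → ℝ) (hφ : ContDiff ℝ ∞ φ), IsOnePeriodic φ ∧ z = P.smoothTriple hφ := by
  obtain ⟨φ, h1, h2, h3, h4, h5⟩ := hz
  refine ⟨φ, h1, h2, Prod.ext ?_ (Prod.ext ?_ (funext fun i => ?_))⟩
  · exact Lp.ext (h3.trans (P.smoothTriple_fst_ae h1).symm)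
  · exact Lp.ext (h4.trans (P.smoothTriple_grad_ae h1).symm)
  · exact Lp.ext ((h5 i).trans (P.smoothTriple_trace_ae h1 i).symm)

/-- The Poincaré inequality is a closed condition on triples, so it passes from smooth functions to
their closure. The constant 2 is the square root of the 4 in `lintegral_sub_mean_sq_le`. -/
theorem norm_sub_cellMean_le {z : P.TripleSpace} (hz : z ∈ P.smoothTriples.topologicalClosure) :
    ‖z.1 - Lp.constL 2 cellMeasure ℝ (cellMean z.1)‖ ≤ 2 * ‖z.2.1‖ := by
  have hcl : IsClosed {z : P.TripleSpace |
      ‖z.1 - Lp.constL 2 cellMeasure ℝ (cellMean z.1)‖ ≤ 2 * ‖z.2.1‖} :=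
    isClosed_le (by fun_prop) (by fun_prop)
  refine closure_minimal (fun z hz => ?_) hcl hz
  obtain ⟨φ, hφ, hp, rfl⟩ := P.exists_eq_smoothTriple hz
  have hmean : cellMean (P.smoothTriple hφ).1 = ∫ y in unitCell, φ y := by
    rw [cellMean_apply]
    exact integral_congr_ae (P.smoothTriple_fst_ae hφ)
  rw [Set.mem_ofPred_eq, hmean]
  have h1 := lintegral_sub_mean_sq_le hφ ((hφ.continuous.memLp_unitCell 2).integrable (by norm_num))
  have h2 : ‖(P.smoothTriple hφ).1 - Lp.constL 2 cellMeasure ℝ (∫ y in unitCell, φ y)‖ₑ ^ 2 ≤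
      2 ^ 2 * ‖(P.smoothTriple hφ).2.1‖ₑ ^ 2 := by
    rw [Lp_enorm_sq, Lp_enorm_sq]
    convert h1 using 1
    · refine lintegral_congr_ae ?_
      filter_upwards [Lp.coeFn_sub (P.smoothTriple hφ).1
        (Lp.constL 2 cellMeasure ℝ (∫ y in unitCell, φ y)),
        Lp.coeFn_const 2 cellMeasure (∫ y in unitCell, φ y),
        P.smoothTriple_fst_ae hφ] with x hx1 hx2 hx3
      have hx2' : (Lp.constL 2 cellMeasure ℝ (∫ y in unitCell, φ y)) x = ∫ y in unitCell, φ y := hx2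
      rw [hx1, Pi.sub_apply, hx2']
      congr 3
    · congr 1
      · norm_num
      · refine lintegral_congr_ae ?_
        filter_upwards [P.smoothTriple_grad_ae hφ] with x hx
        congr 2
  rw [← mul_pow] at h2
  have h3 := ENNReal.toReal_mono (by finiteness) ((ENNReal.pow_le_pow_left_iff (by norm_num)).1 h2)
  simpa [ENNReal.toReal_mul] using h3

theorem exists_norm_trace_le (i : Fin n) : ∃ C : NNReal, ∀ z ∈ P.smoothTriples.topologicalClosure,
    ‖z.2.2 i‖ ^ 2 ≤ C * (‖z.1‖ ^ 2 + ‖z.2.1‖ ^ 2) := by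
  obtain ⟨C, hC⟩ := exists_trace_bound (fun s hs => P.hasDerivWithinAt_curve i hs)
    (P.continuousOn_tangent i) (fun s hs h => by simpa [h] using P.norm_tangent i hs)
  refine ⟨C, fun z hz => ?_⟩
  have hcl : IsClosed {z : P.TripleSpace | ‖z.2.2 i‖ ^ 2 ≤ C * (‖z.1‖ ^ 2 + ‖z.2.1‖ ^ 2)} :=
    isClosed_le (by fun_prop) (by fun_prop)
  refine closure_minimal (fun z hz => ?_) hcl hz
  obtain ⟨φ, hφ, hp, rfl⟩ := P.exists_eq_smoothTriple hz
  have h1 := hC φ hφ hp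
  rw [lintegral_add_left (hφ.continuous.enorm.measurable.pow_const 2)] at h1
  have h2 : ‖(P.smoothTriple hφ).2.2 i‖ₑ ^ 2 ≤
      C * (‖(P.smoothTriple hφ).1‖ₑ ^ 2 + ‖(P.smoothTriple hφ).2.1‖ₑ ^ 2) := by
    rw [Lp_enorm_sq, Lp_enorm_sq, Lp_enorm_sq]
    convert h1 using 1
    · refine lintegral_congr_ae ?_
      filter_upwards [P.smoothTriple_trace_ae hφ i] with x hx
      congr 2
    · congr 2
      · refine lintegral_congr_ae ?_
        filter_upwards [P.smoothTriple_fst_ae hφ] with x hx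
        congr 2
      · refine lintegral_congr_ae ?_
        filter_upwards [P.smoothTriple_grad_ae hφ] with x hx
        congr 2
  have h3 := ENNReal.toReal_mono (by finiteness) h2
  rw [ENNReal.toReal_mul, ENNReal.toReal_add (by finiteness) (by finiteness)] at h3
  simpa using h3

/-- The tuples `(v, ∇v, (v|_γ), (v_s|_γ))` of square integrable functions. -/
abbrev TupleSpace : Type := P.TripleSpace × (∀ i, Lp ℝ 2 (P.arcMeasure i))

/-- Integration along the `i`-th curve from its initial point. -/
noncomputable def primitive (i : Fin n) : Lp ℝ 2 (P.arcMeasure i) →L[ℝ] Lp ℝ 2 (P.arcMeasure i) :=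
  (exists_primitive (P.length i)).choose

theorem primitive_ae_eq (i : Fin n) (d : Lp ℝ 2 (P.arcMeasure i)) :
    P.primitive i d =ᵐ[P.arcMeasure i] fun s => ∫ t in (0 : ℝ)..s, d t :=
  (exists_primitive (P.length i)).choose_spec d

/-- The function component of a tuple. -/
noncomputable def tupleVal : P.TupleSpace →L[ℝ] Lp ℝ 2 cellMeasure :=
  (ContinuousLinearMap.fst ℝ (Lp ℝ 2 cellMeasure)
    (Lp Plane 2 cellMeasure × (∀ i, Lp ℝ 2 (P.arcMeasure i)))).comp
    (ContinuousLinearMap.fst ℝ P.TripleSpace (∀ i, Lp ℝ 2 (P.arcMeasure i)))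

/-- The gradient component of a tuple. -/
noncomputable def tupleGrad : P.TupleSpace →L[ℝ] Lp Plane 2 cellMeasure :=
  ((ContinuousLinearMap.fst ℝ (Lp Plane 2 cellMeasure) (∀ i, Lp ℝ 2 (P.arcMeasure i))).comp
    (ContinuousLinearMap.snd ℝ (Lp ℝ 2 cellMeasure)
      (Lp Plane 2 cellMeasure × (∀ i, Lp ℝ 2 (P.arcMeasure i))))).comp
    (ContinuousLinearMap.fst ℝ P.TripleSpace (∀ i, Lp ℝ 2 (P.arcMeasure i)))

/-- The trace component of a tuple. -/
noncomputable def tupleTrace (i : Fin n) : P.TupleSpace →L[ℝ] Lp ℝ 2 (P.arcMeasure i) :=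
  (((ContinuousLinearMap.proj i).comp
    (ContinuousLinearMap.snd ℝ (Lp Plane 2 cellMeasure) (∀ i, Lp ℝ 2 (P.arcMeasure i)))).comp
    (ContinuousLinearMap.snd ℝ (Lp ℝ 2 cellMeasure)
      (Lp Plane 2 cellMeasure × (∀ i, Lp ℝ 2 (P.arcMeasure i))))).comp
    (ContinuousLinearMap.fst ℝ P.TripleSpace (∀ i, Lp ℝ 2 (P.arcMeasure i)))

/-- The component of a tuple that stands for the derivative of the trace. -/
noncomputable def tupleDeriv (i : Fin n) : P.TupleSpace →L[ℝ] Lp ℝ 2 (P.arcMeasure i) :=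
  (ContinuousLinearMap.proj i).comp
    (ContinuousLinearMap.snd ℝ P.TripleSpace (∀ i, Lp ℝ 2 (P.arcMeasure i)))

/-- The closed subspace of the tuples of cell functions. -/
noncomputable def cellSubspace : Submodule ℝ P.TupleSpace :=
  (P.smoothTriples.topologicalClosure.comap
      (ContinuousLinearMap.fst ℝ P.TripleSpace (∀ i, Lp ℝ 2 (P.arcMeasure i))).toLinearMap ⊓
    (cellMean.comp P.tupleVal).ker) ⊓
    -- This is the relation between a trace and its derivative, up to the unknown initial value:
    -- trace minus primitive is a constant. It is a closed condition because the constants form a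
    -- finite-dimensional space.
    ⨅ i, (Lp.constL 2 (P.arcMeasure i) ℝ : ℝ →L[ℝ] Lp ℝ 2 (P.arcMeasure i)).range.comap
      (P.tupleTrace i - (P.primitive i).comp (P.tupleDeriv i)).toLinearMap

theorem mem_cellSubspace {z : P.TupleSpace} : z ∈ P.cellSubspace ↔
    (z.1 ∈ P.smoothTriples.topologicalClosure ∧ cellMean z.1.1 = 0) ∧
      ∀ i, ∃ c : ℝ, Lp.constL 2 (P.arcMeasure i) ℝ c = z.1.2.2 i - P.primitive i (z.2 i) := by
  simp only [cellSubspace, Submodule.mem_inf, Submodule.mem_iInf, Submodule.mem_comap]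
  rfl

theorem isClosed_cellSubspace : IsClosed (P.cellSubspace : Set P.TupleSpace) := by
  unfold cellSubspace
  simp only [Submodule.coe_inf, Submodule.coe_iInf]
  refine IsClosed.inter (IsClosed.inter ?_ ?_) (isClosed_iInter fun i => ?_)
  · exact P.smoothTriples.isClosed_topologicalClosure.preimage (ContinuousLinearMap.continuous _)
  · exact ContinuousLinearMap.isClosed_ker _
  · exact (Submodule.closed_of_finiteDimensional
      (Lp.constL 2 (P.arcMeasure i) ℝ : ℝ →L[ℝ] Lp ℝ 2 (P.arcMeasure i)).range).preimage
      (P.tupleTrace i - (P.primitive i).comp (P.tupleDeriv i)).continuous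

end PeriodicPattern

/-! ### The energy space and the existence of correctors -/

namespace PeriodicPattern

variable {n : ℕ} (P : PeriodicPattern n)

/-- The Hilbert space of gradient fields and derivatives along the curves. -/
abbrev EnergySpace : Type :=
  WithLp 2 (Lp Plane 2 cellMeasure × PiLp 2 (fun i => Lp ℝ 2 (P.arcMeasure i)))

/-- The map `(v, ∇v, (v|_γ), (v_s|_γ)) ↦ (∇v, (√a v_s|_γ))`. -/
noncomputable def energyMap (a : ℝ) : P.TupleSpace →L[ℝ] P.EnergySpace :=
  ((WithLp.prodContinuousLinearEquiv 2 ℝ (Lp Plane 2 cellMeasure)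
    (PiLp 2 (fun i => Lp ℝ 2 (P.arcMeasure i)))).symm :
      _ →L[ℝ] P.EnergySpace).comp (P.tupleGrad.prod
    (((PiLp.continuousLinearEquiv 2 ℝ (fun i => Lp ℝ 2 (P.arcMeasure i))).symm :
      _ →L[ℝ] PiLp 2 (fun i => Lp ℝ 2 (P.arcMeasure i))).comp
        (ContinuousLinearMap.pi fun i => √a • P.tupleDeriv i)))

theorem energyMap_fst (a : ℝ) (z : P.TupleSpace) : (P.energyMap a z).ofLp.1 = z.1.2.1 := rfl

theorem energyMap_snd (a : ℝ) (z : P.TupleSpace) (i : Fin n) :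
    (P.energyMap a z).ofLp.2.ofLp i = √a • z.2 i := rfl

/-- Coercivity, with N the energy norm. Poincaré for mean zero bounds the function by 2N, the
derivative components carry the factor 1/√a, and the trace inequality bounds each squared trace by C
(4 + 1) N². The constant is the sum of all these bounds. -/
theorem exists_norm_le_energyMap {a : ℝ} (ha : 0 < a) :
    ∃ K : NNReal, ∀ z ∈ P.cellSubspace, ‖z‖ ≤ K * ‖P.energyMap a z‖ := by
  choose C hC using P.exists_norm_trace_le
  refine ⟨2 + (√a).toNNReal⁻¹ + ∑ i, NNReal.sqrt (5 * C i), fun z hz => ?_⟩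
  obtain ⟨⟨h1, h2⟩, -⟩ := P.mem_cellSubspace.1 hz
  set N := ‖P.energyMap a z‖ with hN
  have hN0 : 0 ≤ N := norm_nonneg _
  have hsq : N ^ 2 = ‖z.1.2.1‖ ^ 2 + ‖(P.energyMap a z).ofLp.2‖ ^ 2 :=
    WithLp.prod_norm_sq_eq_of_L2 (P.energyMap a z)
  have hg : ‖z.1.2.1‖ ≤ N := by
    refine abs_le_of_sq_le_sq' ?_ hN0 |>.2
    rw [hsq]
    exact le_add_of_nonneg_right (sq_nonneg _)
  have hd' : ‖(P.energyMap a z).ofLp.2‖ ≤ N := by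
    refine abs_le_of_sq_le_sq' ?_ hN0 |>.2
    rw [hsq]
    exact le_add_of_nonneg_left (sq_nonneg _)
  have hu : ‖z.1.1‖ ≤ 2 * ‖z.1.2.1‖ := by
    have := P.norm_sub_cellMean_le h1
    rwa [h2, map_zero, sub_zero] at this
  have hsa : 0 < √a := Real.sqrt_pos.2 ha
  have hd : ∀ i, ‖z.2 i‖ ≤ (√a)⁻¹ * N := fun i => by
    have h3 : ‖√a • z.2 i‖ ≤ N :=
      (PiLp.norm_apply_le (P.energyMap a z).ofLp.2 i).trans hd'
    rw [norm_smul, Real.norm_of_nonneg hsa.le] at h3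
    rw [inv_mul_eq_div, le_div_iff₀ hsa]
    linarith
  have ht : ∀ i, ‖z.1.2.2 i‖ ≤ √(5 * C i) * N := fun i => by
    have h3 := hC i z.1 h1
    have h4 : ‖z.1.2.2 i‖ ^ 2 ≤ (5 * C i) * N ^ 2 := by
      refine h3.trans ?_
      have h5 : ‖z.1.1‖ ^ 2 + ‖z.1.2.1‖ ^ 2 ≤ 5 * N ^ 2 := by
        nlinarith [norm_nonneg z.1.1, norm_nonneg z.1.2.1]
      nlinarith [mul_le_mul_of_nonneg_left h5 (C i).2]
    have h5 := Real.sqrt_le_sqrt h4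
    rwa [Real.sqrt_sq (norm_nonneg _), Real.sqrt_mul (by positivity), Real.sqrt_sq hN0] at h5
  have hK : ((2 + (√a).toNNReal⁻¹ + ∑ i, NNReal.sqrt (5 * C i) : NNReal) : ℝ) =
      2 + (√a)⁻¹ + ∑ i, √(5 * C i) := by
    push_cast
    rw [Real.coe_toNNReal _ hsa.le]
  rw [hK]
  have hsum0 : 0 ≤ ∑ i, √(5 * (C i : ℝ)) := Finset.sum_nonneg fun i _ => Real.sqrt_nonneg _
  have hsum : ∀ i, √(5 * (C i : ℝ)) ≤ ∑ i, √(5 * (C i : ℝ)) := fun i =>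
    Finset.single_le_sum (f := fun i => √(5 * (C i : ℝ))) (fun i _ => Real.sqrt_nonneg _)
      (Finset.mem_univ i)
  have hia : 0 < (√a)⁻¹ := inv_pos.2 hsa
  refine max_le (max_le ?_ (max_le ?_ ?_)) ?_
  · nlinarith
  · nlinarith
  · refine (pi_norm_le_iff_of_nonneg (by positivity)).2 fun i => (ht i).trans ?_
    exact mul_le_mul_of_nonneg_right (by linarith [hsum i]) hN0
  · refine (pi_norm_le_iff_of_nonneg (by positivity)).2 fun i => (hd i).trans ?_
    exact mul_le_mul_of_nonneg_right (by linarith) hN0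

/-- The image of the space of cell functions in the energy space. -/
noncomputable def energySubspace (a : ℝ) : Submodule ℝ P.EnergySpace :=
  P.cellSubspace.map (P.energyMap a).toLinearMap

/-- A continuous linear map that is bounded below on a complete space has closed range. -/
theorem isClosed_energySubspace {a : ℝ} (ha : 0 < a) :
    IsClosed (P.energySubspace a : Set P.EnergySpace) := by
  obtain ⟨K, hK⟩ := P.exists_norm_le_energyMap ha
  have : CompleteSpace P.cellSubspace := P.isClosed_cellSubspace.completeSpace_coe
  have h1 : AntilipschitzWith K ((P.energyMap a).comp P.cellSubspace.subtypeL) :=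
    ContinuousLinearMap.antilipschitz_of_bound _ fun z => hK z z.2
  have h2 : (P.energySubspace a : Set P.EnergySpace) =
      Set.range ((P.energyMap a).comp P.cellSubspace.subtypeL) := by
    ext y
    simp [energySubspace]
  rw [h2]
  exact h1.isClosed_range (ContinuousLinearMap.uniformContinuous _)

theorem continuousOn_primitive_of_memLp {L : ℝ} {d : ℝ → ℝ}
    (hd : MemLp d 2 (volume.restrict (Set.Icc 0 L))) :
    ContinuousOn (fun s => ∫ t in (0 : ℝ)..s, d t) (Set.Icc 0 L) := by
  rcases le_total 0 L with h | h
  · rw [← Set.uIcc_of_le h]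
    refine intervalIntegral.continuousOn_primitive_interval ?_
    rw [Set.uIcc_of_le h]
    exact hd.integrable (by norm_num)
  · exact (Set.subsingleton_Icc_of_ge h).continuousOn _

theorem CellFunction.continuousOn_trace {P : PeriodicPattern n} (v : P.CellFunction) (i : Fin n) :
    ContinuousOn (v.trace i) (Set.Icc 0 (P.length i)) :=
  (continuousOn_const.add (continuousOn_primitive_of_memLp (v.memLp_traceDeriv i))).congr
    (v.trace_eq i)

theorem CellFunction.memLp_trace {P : PeriodicPattern n} (v : P.CellFunction) (i : Fin n) :
    MemLp (v.trace i) 2 (P.arcMeasure i) :=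
  (v.continuousOn_trace i).memLp_restrict_of_isCompact isCompact_Icc measurableSet_Icc 2

/-- The tuple of a cell function. -/
noncomputable def CellFunction.tuple {P : PeriodicPattern n} (v : P.CellFunction) : P.TupleSpace :=
  ((v.memLp_val.toLp, v.memLp_grad.toLp, fun i => (v.memLp_trace i).toLp),
    fun i => (v.memLp_traceDeriv i).toLp)

theorem CellFunction.tuple_mem {P : PeriodicPattern n} (v : P.CellFunction) :
    v.tuple ∈ P.cellSubspace := by
  refine P.mem_cellSubspace.2 ⟨⟨?_, ?_⟩, fun i => ⟨v.trace i 0, ?_⟩⟩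
  · obtain ⟨φ, h1, h2, h3, h4⟩ := v.approx
    refine mem_closure_of_tendsto (f := fun j => P.smoothTriple (h1 j).1) (b := atTop) ?_
      (Eventually.of_forall fun j => P.smoothTriple_mem (h1 j).1 (h1 j).2)
    refine Tendsto.prodMk_nhds ?_ (Tendsto.prodMk_nhds ?_ (tendsto_pi_nhds.2 fun i => ?_))
    · exact (Lp.tendsto_Lp_iff_tendsto_eLpNorm'' φ _ _ v.memLp_val).2 h2
    · exact (Lp.tendsto_Lp_iff_tendsto_eLpNorm'' (fun j => gradient (φ j)) _ _ v.memLp_grad).2 h3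
    · exact (Lp.tendsto_Lp_iff_tendsto_eLpNorm'' (fun j s => φ j (P.curve i s)) _ _
        (v.memLp_trace i)).2 (h4 i)
  · rw [cellMean_apply, ← v.mean_zero]
    exact integral_congr_ae (MemLp.coeFn_toLp v.memLp_val)
  · refine Lp.ext ?_
    have h1 := P.primitive_ae_eq i (v.memLp_traceDeriv i).toLp
    filter_upwards [Lp.coeFn_const 2 (P.arcMeasure i) (v.trace i 0), h1,
      Lp.coeFn_sub (v.tuple.1.2.2 i) (P.primitive i (v.tuple.2 i)),
      MemLp.coeFn_toLp (v.memLp_trace i), ae_restrict_mem measurableSet_Icc] with s hs1 hs2 hs3 hs4 hs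
    have hs1' : (Lp.constL 2 (P.arcMeasure i) ℝ (v.trace i 0)) s = v.trace i 0 := hs1
    rw [hs1', hs3, Pi.sub_apply]
    have hs4' : (v.tuple.1.2.2 i) s = v.trace i s := hs4
    have hs2' : (P.primitive i (v.tuple.2 i)) s = ∫ t in (0 : ℝ)..s, v.traceDeriv i t := by
      refine hs2.trans (intervalIntegral.integral_congr_ae ?_)
      have h := (ae_restrict_iff' measurableSet_Icc).1 (MemLp.coeFn_toLp (v.memLp_traceDeriv i))
      filter_upwards [h] with t ht hts
      rw [Set.uIoc_of_le hs.1] at hts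
      exact ht ⟨hts.1.le, hts.2.trans hs.2⟩
    rw [hs4', hs2', v.trace_eq i s hs]
    ring

/-- Converse of `CellFunction.tuple_mem`: the continuous representative of each trace is the
constant supplied by the subspace plus the primitive of the derivative component. -/
theorem exists_cellFunction_of_mem {z : P.TupleSpace} (hz : z ∈ P.cellSubspace) :
    ∃ v : P.CellFunction, v.grad = z.1.2.1 ∧ ∀ i, v.traceDeriv i = z.2 i := by
  obtain ⟨⟨h1, h2⟩, h3⟩ := P.mem_cellSubspace.1 hz
  choose c hc using h3
  obtain ⟨ζ, hζ, hlim⟩ := mem_closure_iff_seq_limit.1 h1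
  choose φ hφ hp heq using fun j => P.exists_eq_smoothTriple (hζ j)
  have htr : ∀ i, z.1.2.2 i =ᵐ[P.arcMeasure i] fun s => c i + ∫ t in (0 : ℝ)..s, z.2 i t := fun i => by
    have h4 : z.1.2.2 i = Lp.constL 2 (P.arcMeasure i) ℝ (c i) + P.primitive i (z.2 i) := by
      rw [hc, sub_add_cancel]
    rw [h4]
    filter_upwards [Lp.coeFn_add (Lp.constL 2 (P.arcMeasure i) ℝ (c i)) (P.primitive i (z.2 i)),
      Lp.coeFn_const 2 (P.arcMeasure i) (c i), P.primitive_ae_eq i (z.2 i)] with s hs1 hs2 hs3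
    have hs2' : (Lp.constL 2 (P.arcMeasure i) ℝ (c i)) s = c i := hs2
    rw [hs1, Pi.add_apply, hs2', hs3]
  have hlim1 : Tendsto (fun j => (ζ j).1) atTop (𝓝 z.1.1) := (continuous_fst.tendsto _).comp hlim
  have hlim2 : Tendsto (fun j => (ζ j).2.1) atTop (𝓝 z.1.2.1) :=
    ((continuous_fst.comp continuous_snd).tendsto _).comp hlim
  have hlim3 : ∀ i, Tendsto (fun j => (ζ j).2.2 i) atTop (𝓝 (z.1.2.2 i)) := fun i =>
    (((continuous_apply i).comp (continuous_snd.comp continuous_snd)).tendsto _).comp hlim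
  refine ⟨{ val := z.1.1
            grad := z.1.2.1
            trace := fun i s => c i + ∫ t in (0 : ℝ)..s, z.2 i t
            traceDeriv := fun i => z.2 i
            memLp_val := Lp.memLp _
            memLp_grad := Lp.memLp _
            approx := ⟨φ, fun j => ⟨hφ j, hp j⟩, ?_, ?_, fun i => ?_⟩
            memLp_traceDeriv := fun i => Lp.memLp _
            trace_eq := fun i s _ => by simp
            mean_zero := by rw [← cellMean_apply]; exact h2 }, rfl, fun i => rfl⟩
  · refine ((Lp.tendsto_Lp_iff_tendsto_eLpNorm' _ _).1 hlim1).congr fun j => eLpNorm_congr_ae ?_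
    have := P.smoothTriple_fst_ae (hφ j)
    rw [← heq j] at this
    exact this.sub EventuallyEq.rfl
  · refine ((Lp.tendsto_Lp_iff_tendsto_eLpNorm' _ _).1 hlim2).congr fun j => eLpNorm_congr_ae ?_
    have := P.smoothTriple_grad_ae (hφ j)
    rw [← heq j] at this
    exact this.sub EventuallyEq.rfl
  · refine ((Lp.tendsto_Lp_iff_tendsto_eLpNorm' _ _).1 (hlim3 i)).congr fun j => eLpNorm_congr_ae ?_
    have := P.smoothTriple_trace_ae (hφ j) i
    rw [← heq j] at this
    exact this.sub (htr i)

theorem intervalIntegral_eq_arcMeasure (i : Fin n) (f : ℝ → ℝ) :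
    ∫ s in (0 : ℝ)..P.length i, f s = ∫ s, f s ∂(P.arcMeasure i) := by
  rw [intervalIntegral.integral_of_le (P.length_pos i).le, integral_Icc_eq_integral_Ioc]

theorem memLp_tangent (i : Fin n) (k : Fin 2) :
    MemLp (fun s => P.tangent i s k) 2 (P.arcMeasure i) :=
  ((by fun_prop : Continuous fun z : Plane => z k).comp_continuousOn
    (P.continuousOn_tangent i)).memLp_restrict_of_isCompact isCompact_Icc measurableSet_Icc 2

/-- The symmetric bilinear form of the corrector problems. -/
noncomputable def dirichletForm {P : PeriodicPattern n} (a : ℝ) (w v : P.CellFunction) : ℝ :=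
  (∫ x in unitCell, inner ℝ (w.grad x) (v.grad x)) +
    a * (∑ i, ∫ s in (0 : ℝ)..P.length i, w.traceDeriv i s * v.traceDeriv i s)

/-- The right-hand side of the `k`-th corrector problem. -/
noncomputable def pull {P : PeriodicPattern n} (k : Fin 2) (v : P.CellFunction) : ℝ :=
  ∑ i, ∫ s in (0 : ℝ)..P.length i, P.tangent i s k * v.traceDeriv i s

theorem isCorrector_iff {P : PeriodicPattern n} {a : ℝ} {k : Fin 2} {w : P.CellFunction} :
    P.IsCorrector a k w ↔ ∀ v, dirichletForm a w v + a * pull k v = 0 := Iff.rfl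

theorem inner_energyMap_tuple {P : PeriodicPattern n} {a : ℝ} (ha : 0 ≤ a)
    (w v : P.CellFunction) :
    inner ℝ (P.energyMap a w.tuple) (P.energyMap a v.tuple) = dirichletForm a w v := by
  rw [dirichletForm, WithLp.prod_inner_apply, PiLp.inner_apply]
  simp only [energyMap_fst, energyMap_snd, real_inner_smul_left, real_inner_smul_right,
    Finset.mul_sum]
  congr 1
  · rw [L2.inner_def]
    refine integral_congr_ae ?_
    filter_upwards [MemLp.coeFn_toLp w.memLp_grad, MemLp.coeFn_toLp v.memLp_grad] with x hx hx'
    exact congrArg₂ (inner ℝ) hx hx'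
  · refine Finset.sum_congr rfl fun i _ => ?_
    rw [← mul_assoc, Real.mul_self_sqrt ha, L2.inner_def, P.intervalIntegral_eq_arcMeasure]
    congr 1
    refine integral_congr_ae ?_
    filter_upwards [MemLp.coeFn_toLp (w.memLp_traceDeriv i),
      MemLp.coeFn_toLp (v.memLp_traceDeriv i)] with s hs hs'
    rw [mul_comm]
    exact congrArg₂ (inner ℝ) hs hs'

/-- The functional v ↦ -a `pull k v` is the inner product with the fixed element `F` = (0, -√a τ_k)
of the energy space. The corrector is therefore a preimage of the orthogonal projection of `F` onto
the admissible pairs. -/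
theorem exists_isCorrector {a : ℝ} (ha : 0 < a) (k : Fin 2) :
    ∃ w : P.CellFunction, P.IsCorrector a k w := by
  have hcl : CompleteSpace (P.energySubspace a) := (P.isClosed_energySubspace ha).completeSpace_coe
  set τ : ∀ i, Lp ℝ 2 (P.arcMeasure i) := fun i => (P.memLp_tangent i k).toLp with hτ
  set F : P.EnergySpace := WithLp.toLp 2 (0, WithLp.toLp 2 fun i => -(√a • τ i)) with hF
  obtain ⟨z, hz, hzF⟩ : (P.energySubspace a).starProjection F ∈ P.energySubspace a :=
    Submodule.starProjection_apply_mem _ _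
  obtain ⟨w, hw1, hw2⟩ := P.exists_cellFunction_of_mem hz
  have hzw : P.energyMap a z = P.energyMap a w.tuple := by
    have h1 : w.tuple.1.2.1 = z.1.2.1 :=
      Lp.ext ((MemLp.coeFn_toLp w.memLp_grad).trans (by rw [hw1]))
    have h2 : ∀ i, w.tuple.2 i = z.2 i := fun i =>
      Lp.ext ((MemLp.coeFn_toLp (w.memLp_traceDeriv i)).trans (by rw [hw2]))
    refine (WithLp.ofLp_injective 2) (Prod.ext h1.symm ((WithLp.ofLp_injective 2) (funext fun i => ?_)))
    rw [energyMap_snd, energyMap_snd, h2]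
  refine ⟨w, fun v => ?_⟩
  have horth := Submodule.starProjection_inner_eq_zero (K := P.energySubspace a) F
    (P.energyMap a v.tuple) (Submodule.mem_map_of_mem v.tuple_mem)
  rw [← hzF] at horth
  have hF1 : inner ℝ F (P.energyMap a v.tuple) = -(a * pull k v) := by
    rw [pull, WithLp.prod_inner_apply, PiLp.inner_apply]
    simp only [hF, energyMap_fst, energyMap_snd, inner_zero_left, zero_add, inner_neg_left,
      real_inner_smul_left, real_inner_smul_right, Finset.sum_neg_distrib, neg_inj, Finset.mul_sum]
    refine Finset.sum_congr rfl fun i _ => ?_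
    rw [← mul_assoc, Real.mul_self_sqrt ha.le, L2.inner_def, P.intervalIntegral_eq_arcMeasure]
    congr 1
    refine integral_congr_ae ?_
    filter_upwards [MemLp.coeFn_toLp (P.memLp_tangent i k),
      MemLp.coeFn_toLp (v.memLp_traceDeriv i)] with s hs1 hs2
    rw [mul_comm]
    exact congrArg₂ (inner ℝ) hs1 hs2
  have h3 : inner ℝ F (P.energyMap a v.tuple) =
      inner ℝ (P.energyMap a w.tuple) (P.energyMap a v.tuple) := by
    rw [← hzw]
    have := horth
    rw [inner_sub_left] at this
    exact sub_eq_zero.1 this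
  rw [hF1, inner_energyMap_tuple ha.le] at h3
  change dirichletForm a w v + a * pull k v = 0
  linarith

end PeriodicPattern

/-! ### Agreement of the traces at a common end point -/

/-- The disc fits into the unit square centred at V, and by periodicity the integral over that
square equals the one over the cell. -/
theorem setLIntegral_ball_le {F : Plane → ENNReal} (hF : Measurable F)
    (hp : ∀ (m : Fin 2 → ℤ) x, F (x + latticeVec m) = F x) (V : Plane) {δ : ℝ} (hδ : δ ≤ 1 / 2) :
    ∫⁻ z in Metric.ball V δ, F z ≤ ∫⁻ z in unitCell, F z := by
  set S : Set Plane := {z | z 0 ∈ Set.Ioc (V 0 - 1 / 2) (V 0 - 1 / 2 + 1) ∧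
    z 1 ∈ Set.Ioc (V 1 - 1 / 2) (V 1 - 1 / 2 + 1)} with hS
  have hSm : MeasurableSet S :=
    ((by fun_prop : Measurable fun z : Plane => z 0) measurableSet_Ioc).inter
      ((by fun_prop : Measurable fun z : Plane => z 1) measurableSet_Ioc)
  have hsub : Metric.ball V δ ⊆ S := fun z hz => by
    rw [mem_ball_iff_norm] at hz
    have h0 := abs_lt.1 (((PiLp.norm_apply_le (z - V) 0).trans_lt hz).trans_le hδ)
    have h1 := abs_lt.1 (((PiLp.norm_apply_le (z - V) 1).trans_lt hz).trans_le hδ)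
    simp only [PiLp.sub_apply] at h0 h1
    refine ⟨⟨?_, ?_⟩, ⟨?_, ?_⟩⟩ <;> linarith [h0.1, h0.2, h1.1, h1.2]
  refine (lintegral_mono_set hsub).trans (le_of_eq ?_)
  have hFm : Measurable fun p : ℝ × ℝ => F (planePoint 0 p.1 p.2) :=
    hF.comp (measurable_planePoint 0)
  have hy : ∀ x, Function.Periodic (fun y => F (planePoint 0 x y)) 1 := fun x y => by
    have h : planePoint 0 x (y + 1) =
        planePoint 0 x y + latticeVec (fun i => if i = 0 then 0 else 1) := by
      rw [← planePoint_int, ← planePoint_add]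
      simp
    simp only [h, hp]
  have hx : Function.Periodic (fun x => ∫⁻ y in Set.Ioo (0 : ℝ) 1, F (planePoint 0 x y)) 1 := by
    intro x
    refine lintegral_congr fun y => ?_
    have h : planePoint 0 (x + 1) y =
        planePoint 0 x y + latticeVec (fun i => if i = 0 then 1 else 0) := by
      rw [← planePoint_int, ← planePoint_add]
      simp
    rw [h, hp]
  rw [setLIntegral_eq_iterated 0 (A := Set.Ioc (V 0 - 1 / 2) (V 0 - 1 / 2 + 1))
    (B := Set.Ioc (V 1 - 1 / 2) (V 1 - 1 / 2 + 1)) hSm (fun x y => by simp [hS, planePoint]) hF,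
    lintegral_unitCell 0 hF]
  simp_rw [(hy _).setLIntegral_Ioc_eq_Ioo]
  exact hx.setLIntegral_Ioc_eq_Ioo _

theorem exists_angle {e : Plane} (he : ‖e‖ = 1) :
    ∃ θ ∈ Set.Icc (-Real.pi) Real.pi, e = planePoint 0 (Real.cos θ) (Real.sin θ) := by
  have hn : ‖(⟨e 0, e 1⟩ : ℂ)‖ = 1 := by
    rw [EuclideanSpace.norm_eq, Fin.sum_univ_two] at he
    rw [Complex.norm_def, Complex.normSq_mk, ← he]
    simp [pow_two]
  refine ⟨Complex.arg ⟨e 0, e 1⟩, ⟨(Complex.neg_pi_lt_arg _).le, Complex.arg_le_pi _⟩, ?_⟩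
  have h0 := Complex.norm_mul_cos_arg (⟨e 0, e 1⟩ : ℂ)
  have h1 := Complex.norm_mul_sin_arg (⟨e 0, e 1⟩ : ℂ)
  rw [hn, one_mul] at h0 h1
  rw [h0, h1]
  exact (planePoint_coords 0 e).symm

theorem planePoint_zero_eq (x y : ℝ) :
    planePoint 0 x y = x • planePoint 0 1 0 + y • planePoint 0 0 1 := by
  ext i
  fin_cases i <;> simp [planePoint]

theorem hasDerivAt_circle (θ : ℝ) : HasDerivAt (fun θ => planePoint 0 (Real.cos θ) (Real.sin θ))
    (planePoint 0 (-Real.sin θ) (Real.cos θ)) θ := by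
  have h := ((Real.hasDerivAt_cos θ).smul_const (planePoint 0 1 0)).add
    ((Real.hasDerivAt_sin θ).smul_const (planePoint 0 0 1))
  rw [← planePoint_zero_eq] at h
  exact h.congr_of_eventuallyEq (Eventually.of_forall fun t => planePoint_zero_eq _ _)

theorem contDiff_circle : ContDiff ℝ 1 (fun θ => planePoint 0 (Real.cos θ) (Real.sin θ)) := by
  have h : (fun θ => planePoint 0 (Real.cos θ) (Real.sin θ)) =
      fun θ => Real.cos θ • planePoint 0 1 0 + Real.sin θ • planePoint 0 0 1 :=
    funext fun _ => planePoint_zero_eq _ _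
  rw [h]
  exact (Real.contDiff_cos.smul contDiff_const).add (Real.contDiff_sin.smul contDiff_const)

theorem norm_planePoint_sq (x y : ℝ) : ‖planePoint 0 x y‖ ^ 2 = x ^ 2 + y ^ 2 := by
  rw [EuclideanSpace.norm_sq_eq, Fin.sum_univ_two]
  simp [planePoint]

/-- The circle of radius r has speed r, so Cauchy–Schwarz over the angle produces r² |∇φ|². The
weight 1/r turns r² into r, the Jacobian of polar coordinates. -/
theorem enorm_sub_circle_sq_le {φ : Plane → ℝ} (hφ : ContDiff ℝ ∞ φ) (V : Plane) {r : ℝ}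
    (hr : 0 < r) {θ θ' : ℝ} (hθ : θ ∈ Set.Icc (-Real.pi) Real.pi)
    (hθ' : θ' ∈ Set.Icc (-Real.pi) Real.pi) :
    ENNReal.ofReal r⁻¹ * ‖φ (V + r • planePoint 0 (Real.cos θ) (Real.sin θ)) -
      φ (V + r • planePoint 0 (Real.cos θ') (Real.sin θ'))‖ₑ ^ 2 ≤
      ENNReal.ofReal (2 * Real.pi) * ∫⁻ t in Set.Ioo (-Real.pi) Real.pi, ENNReal.ofReal r *
        ‖gradient φ (V + r • planePoint 0 (Real.cos t) (Real.sin t))‖ₑ ^ 2 := by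
  have hc : ContDiff ℝ 1 (fun t => V + r • planePoint 0 (Real.cos t) (Real.sin t)) :=
    contDiff_const.add (contDiff_circle.const_smul r)
  have hm : Measurable fun t =>
      ‖gradient φ (V + r • planePoint 0 (Real.cos t) (Real.sin t))‖ₑ :=
    ((continuous_gradient hφ).comp hc.continuous).enorm.measurable
  have hd : ∀ t, ‖deriv (fun t => V + r • planePoint 0 (Real.cos t) (Real.sin t)) t‖ ≤ r := by
    intro t
    have hder : HasDerivAt (fun t => V + r • planePoint 0 (Real.cos t) (Real.sin t))
        (r • planePoint 0 (-Real.sin t) (Real.cos t)) t :=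
      ((hasDerivAt_circle t).const_smul r).const_add V
    rw [hder.deriv, norm_smul,
      Real.norm_of_nonneg hr.le]
    have h1 : ‖planePoint 0 (-Real.sin t) (Real.cos t)‖ ^ 2 = 1 := by
      rw [norm_planePoint_sq, neg_sq, Real.sin_sq_add_cos_sq]
    have h2 : ‖planePoint 0 (-Real.sin t) (Real.cos t)‖ = 1 :=
      (pow_eq_one_iff_of_nonneg (norm_nonneg _) two_ne_zero).1 h1
    rw [h2, mul_one]
  have h := enorm_sub_le_lintegral_gradient hφ hc hd hθ hθ'
  have h2 := ENNReal.pow_le_pow_left (n := 2) h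
  rw [mul_pow] at h2
  have h3 := sq_lintegral_le (volume.restrict (Set.Ioo (-Real.pi) Real.pi)) hm.aemeasurable
  simp only [Measure.restrict_apply, MeasurableSet.univ, Set.univ_inter, Real.volume_Ioo,
    sub_neg_eq_add, ← two_mul] at h3
  have hrr : ENNReal.ofReal r⁻¹ * ENNReal.ofReal r ^ 2 = ENNReal.ofReal r := by
    rw [← ENNReal.ofReal_pow hr.le, ← ENNReal.ofReal_mul (by positivity)]
    congr 1
    field_simp
  rw [lintegral_const_mul _ (hm.pow_const 2)]
  calc _ ≤ ENNReal.ofReal r⁻¹ * (ENNReal.ofReal r ^ 2 * (ENNReal.ofReal (2 * Real.pi) *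
        ∫⁻ t in Set.Ioo (-Real.pi) Real.pi,
          ‖gradient φ (V + r • planePoint 0 (Real.cos t) (Real.sin t))‖ₑ ^ 2)) := by
        gcongr
        exact h2.trans (by gcongr)
    _ = (ENNReal.ofReal r⁻¹ * ENNReal.ofReal r ^ 2) * (ENNReal.ofReal (2 * Real.pi) *
        ∫⁻ t in Set.Ioo (-Real.pi) Real.pi,
          ‖gradient φ (V + r • planePoint 0 (Real.cos t) (Real.sin t))‖ₑ ^ 2) := by ring
    _ = _ := by rw [hrr]; ring

/-- The Dirichlet integral over a disc in polar coordinates. -/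
theorem lintegral_polar_ball (V : Plane) {δ : ℝ} {F : Plane → ENNReal} (hF : Measurable F) :
    ∫⁻ r in Set.Ioo 0 δ, ∫⁻ t in Set.Ioo (-Real.pi) Real.pi, ENNReal.ofReal r *
      F (V + r • planePoint 0 (Real.cos t) (Real.sin t)) = ∫⁻ z in Metric.ball V δ, F z := by
  set G : Plane → ENNReal := (Metric.ball V δ).indicator F with hG
  have hGm : Measurable G := hF.indicator measurableSet_ball
  have h1 : ∫⁻ z in Metric.ball V δ, F z = ∫⁻ p : ℝ × ℝ, G (V + planePoint 0 p.1 p.2) := by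
    rw [← lintegral_indicator measurableSet_ball, ← lintegral_add_left_eq_self _ V]
    exact ((measurePreserving_planePoint 0).lintegral_comp (hGm.comp (measurable_const_add V))).symm
  have hball : ∀ r t : ℝ, 0 < r →
      (V + r • planePoint 0 (Real.cos t) (Real.sin t) ∈ Metric.ball V δ ↔ r < δ) := by
    intro r t hr
    have h3 : ‖planePoint 0 (Real.cos t) (Real.sin t)‖ ^ 2 = 1 := by
      rw [norm_planePoint_sq, Real.cos_sq_add_sin_sq]
    have h2 : ‖planePoint 0 (Real.cos t) (Real.sin t)‖ = 1 :=
      (pow_eq_one_iff_of_nonneg (norm_nonneg _) two_ne_zero).1 h3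
    rw [mem_ball_iff_norm, add_sub_cancel_left, norm_smul, h2, mul_one, Real.norm_of_nonneg hr.le]
  have hm : Measurable fun p : ℝ × ℝ => ENNReal.ofReal p.1 *
      G (V + p.1 • planePoint 0 (Real.cos p.2) (Real.sin p.2)) := by
    refine (ENNReal.measurable_ofReal.comp measurable_fst).mul (hGm.comp ?_)
    refine Continuous.measurable ?_
    have hcc : Continuous fun p : ℝ × ℝ => planePoint 0 (Real.cos p.2) (Real.sin p.2) :=
      contDiff_circle.continuous.comp continuous_snd
    exact continuous_const.add (continuous_fst.smul hcc)
  rw [h1, ← lintegral_comp_polarCoord_symm]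
  have h4 : ∀ p : ℝ × ℝ, ENNReal.ofReal p.1 • G (V + planePoint 0 (polarCoord.symm p).1
      (polarCoord.symm p).2) = ENNReal.ofReal p.1 *
        G (V + p.1 • planePoint 0 (Real.cos p.2) (Real.sin p.2)) := fun p => by
    rw [smul_eq_mul]
    congr 3
    ext i
    fin_cases i <;> simp [planePoint, polarCoord_symm_apply]
  simp_rw [h4]
  rw [polarCoord_target, Measure.volume_eq_prod, ← Measure.prod_restrict,
    lintegral_prod _ hm.aemeasurable, ← Set.Ioi_inter_Iio]
  rw [← lintegral_indicator measurableSet_Ioi, ← lintegral_indicator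
    (measurableSet_Ioi.inter measurableSet_Iio)]
  refine lintegral_congr fun r => ?_
  by_cases hr : 0 < r
  · by_cases hrδ : r < δ
    · rw [Set.indicator_of_mem (show r ∈ Set.Ioi 0 ∩ Set.Iio δ from ⟨hr, hrδ⟩),
        Set.indicator_of_mem (show r ∈ Set.Ioi 0 from hr)]
      refine lintegral_congr fun t => ?_
      rw [hG, Set.indicator_of_mem ((hball r t hr).2 hrδ)]
    · rw [Set.indicator_of_notMem (fun h => hrδ h.2),
        Set.indicator_of_mem (show r ∈ Set.Ioi 0 from hr)]
      have : ∀ t, G (V + r • planePoint 0 (Real.cos t) (Real.sin t)) = 0 := fun t => by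
        rw [hG, Set.indicator_of_notMem (fun h => hrδ ((hball r t hr).1 h))]
      simp [this]
  · rw [Set.indicator_of_notMem (fun h => hr h.1),
      Set.indicator_of_notMem (show r ∉ Set.Ioi 0 from hr)]

/-- Integrating the estimate on circles over the radius yields the Dirichlet integral over a disc.
Only the L² norm of the gradient enters, so the bound survives passage to limits in H¹. -/
theorem lintegral_ray_sub_sq_le {φ : Plane → ℝ} (hφ : ContDiff ℝ ∞ φ) (hp : IsOnePeriodic φ)
    (V : Plane) {δ : ℝ} (hδ : δ ≤ 1 / 2) {e e' : Plane} (he : ‖e‖ = 1) (he' : ‖e'‖ = 1) :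
    ∫⁻ r in Set.Ioo 0 δ, ENNReal.ofReal r⁻¹ * ‖φ (V + r • e) - φ (V + r • e')‖ₑ ^ 2 ≤
      ENNReal.ofReal (2 * Real.pi) * ∫⁻ z in unitCell, ‖gradient φ z‖ₑ ^ 2 := by
  obtain ⟨θ, hθ, rfl⟩ := exists_angle he
  obtain ⟨θ', hθ', rfl⟩ := exists_angle he'
  have hG : Measurable fun z => ‖gradient φ z‖ₑ ^ 2 :=
    ((continuous_gradient hφ).enorm.measurable).pow_const 2
  refine (setLIntegral_mono' measurableSet_Ioo
    fun r hr => enorm_sub_circle_sq_le hφ V hr.1 hθ hθ').trans ?_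
  rw [lintegral_const_mul' _ _ ENNReal.ofReal_ne_top, lintegral_polar_ball V hG]
  exact mul_le_mul' le_rfl (setLIntegral_ball_le hG (fun m x => by rw [gradient_add_latticeVec hp]) V hδ)

/-- If h(0) were nonzero, |h| would stay above |h(0)|/2 near 0, and the integral of 1/r diverges
there. A bound uniform in ε suffices, so no control at r = 0 is needed. -/
theorem eq_zero_of_lintegral_inv_mul_le {h : ℝ → ℝ} {δ : ℝ} (hδ : 0 < δ)
    (hc : ContinuousOn h (Set.Icc 0 δ)) {M : ENNReal} (hM : M ≠ ⊤)
    (hle : ∀ ε ∈ Set.Ioo 0 δ, ∫⁻ r in Set.Ioo ε δ, ENNReal.ofReal r⁻¹ * ‖h r‖ₑ ^ 2 ≤ M) :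
    h 0 = 0 := by
  by_contra hne
  set c := |h 0| / 2 with hcdef
  have hcpos : 0 < c := by positivity
  have h0 : (0 : ℝ) ∈ Set.Icc 0 δ := ⟨le_rfl, hδ.le⟩
  obtain ⟨η, hη, hball⟩ := Metric.mem_nhdsWithin_iff.1
    ((hc 0 h0).eventually (Metric.ball_mem_nhds (h 0) hcpos))
  set d := min η δ with hd
  have hd0 : 0 < d := lt_min hη hδ
  have hlow : ∀ r ∈ Set.Ioo 0 d, c ≤ |h r| := fun r hr => by
    have h1 : r ∈ Metric.ball (0 : ℝ) η ∩ Set.Icc 0 δ := by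
      refine ⟨?_, hr.1.le, hr.2.le.trans (min_le_right _ _)⟩
      rw [mem_ball_zero_iff, Real.norm_of_nonneg hr.1.le]
      exact hr.2.trans_le (min_le_left _ _)
    have h2 : |h r - h 0| < c := hball h1
    have h3 := abs_sub_abs_le_abs_sub (h 0) (h r)
    rw [abs_sub_comm] at h3
    have : |h 0| = 2 * c := by rw [hcdef]; ring
    linarith
  have hlog : ∀ ε ∈ Set.Ioo 0 d, ENNReal.ofReal (c ^ 2 * Real.log (d / ε)) ≤ M := by
    intro ε hε
    have h1 : ∫⁻ r in Set.Ioo ε d, ENNReal.ofReal (c ^ 2 * r⁻¹) ≤ M := by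
      refine le_trans ?_ (hle ε ⟨hε.1, hε.2.trans_le (min_le_right _ _)⟩)
      refine le_trans (setLIntegral_mono' measurableSet_Ioo fun r hr => ?_)
        (lintegral_mono_set (Set.Ioo_subset_Ioo_right (min_le_right η δ)))
      have hr0 : 0 < r := hε.1.trans hr.1
      rw [mul_comm, ENNReal.ofReal_mul (by positivity), ← ofReal_norm, ← ENNReal.ofReal_pow
        (norm_nonneg _)]
      gcongr
      exact hlow r ⟨hr0, hr.2⟩
    have h2 : ∫⁻ r in Set.Ioo ε d, ENNReal.ofReal (c ^ 2 * r⁻¹) =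
        ENNReal.ofReal (∫ r in Set.Ioo ε d, c ^ 2 * r⁻¹) := by
      rw [ofReal_integral_eq_lintegral_ofReal]
      · have : ContinuousOn (fun r : ℝ => c ^ 2 * r⁻¹) (Set.Icc ε d) :=
          continuousOn_const.mul (continuousOn_inv₀.mono fun r hr => (hε.1.trans_le hr.1).ne')
        exact this.integrableOn_Icc.mono_set Set.Ioo_subset_Icc_self
      · filter_upwards [ae_restrict_mem measurableSet_Ioo] with r hr
        have hr0 : 0 < r := hε.1.trans hr.1
        positivity
    rw [h2, ← integral_Ioc_eq_integral_Ioo, ← intervalIntegral.integral_of_le hε.2.le,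
      intervalIntegral.integral_const_mul, integral_inv_of_pos hε.1 hd0] at h1
    exact h1
  have hlog2 : ∀ ε ∈ Set.Ioo 0 d, c ^ 2 * Real.log (d / ε) ≤ M.toReal := fun ε hε =>
    (ENNReal.ofReal_le_iff_le_toReal hM).1 (hlog ε hε)
  have hK : 0 ≤ M.toReal := ENNReal.toReal_nonneg
  set K := (M.toReal + 1) / c ^ 2 with hKdef
  have hKpos : 0 < K := by positivity
  -- For this ε the logarithm log(d/ε) equals K, and c² K exceeds the supposed bound by 1.
  have := hlog2 (d * Real.exp (-K)) ⟨by positivity, by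
    have : Real.exp (-K) < 1 := Real.exp_lt_one_iff.2 (by linarith)
    nlinarith⟩
  rw [div_mul_cancel_left₀ hd0.ne', Real.exp_neg, inv_inv, Real.log_exp, hKdef,
    mul_div_cancel₀ _ (by positivity)] at this
  linarith

theorem eLpNorm_two_sq {α E : Type*} [MeasurableSpace α] [NormedAddCommGroup E] {μ : Measure α}
    (f : α → E) : eLpNorm f 2 μ ^ 2 = ∫⁻ x, ‖f x‖ₑ ^ 2 ∂μ := by
  have := eLpNorm_nnreal_pow_eq_lintegral (μ := μ) (f := f) (p := 2) (by norm_num)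
  simpa using this

namespace PeriodicPattern

variable {n : ℕ} (P : PeriodicPattern n)

/-- The arc length parameter of the point of the `i`-th curve at distance `r` (along the curve)
from its end `b`. -/
noncomputable def endParam (i : Fin n) (b : Bool) (r : ℝ) : ℝ := if b then P.length i - r else r

theorem endParam_mem (i : Fin n) (b : Bool) {r : ℝ} (hr : r ∈ Set.Icc 0 (P.length i)) :
    P.endParam i b r ∈ Set.Icc 0 (P.length i) := by
  unfold endParam
  split_ifs
  · exact ⟨sub_nonneg.2 hr.2, sub_le_self _ hr.1⟩
  · exact hr

theorem continuous_endParam (i : Fin n) (b : Bool) : Continuous (P.endParam i b) := by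
  unfold endParam
  split_ifs <;> fun_prop

theorem lintegral_comp_endParam_le (i : Fin n) (b : Bool) {ε δ : ℝ} (hε : 0 ≤ ε)
    (hδ : δ ≤ P.length i) (F : ℝ → ENNReal) :
    ∫⁻ r in Set.Ioo ε δ, F (P.endParam i b r) ≤ ∫⁻ s in Set.Icc 0 (P.length i), F s := by
  have hsub : Set.Ioo ε δ ⊆ Set.Icc 0 (P.length i) := fun r hr =>
    ⟨hε.trans hr.1.le, hr.2.le.trans hδ⟩
  unfold endParam
  split_ifs
  · have h := (Measure.measurePreserving_sub_left volume (P.length i)).setLIntegral_comp_preimage_emb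
      (MeasurableEquiv.subLeft (P.length i)).measurableEmbedding F (Set.Icc 0 (P.length i))
    rw [← h]
    refine lintegral_mono_set fun r hr => ?_
    exact ⟨sub_nonneg.2 (hsub hr).2, sub_le_self _ (hsub hr).1⟩
  · exact lintegral_mono_set hsub

variable {P}

theorem IsStraight.exists_tangent {i : Fin n} (h : P.IsStraight i) : ∃ u : Plane, ‖u‖ = 1 ∧
    (∀ s ∈ Set.Icc 0 (P.length i), P.curve i s = P.curve i 0 + s • u) ∧
    ∀ s ∈ Set.Icc 0 (P.length i), P.tangent i s = u := by
  obtain ⟨u, hu⟩ := h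
  have ht : ∀ s ∈ Set.Icc 0 (P.length i), P.tangent i s = u := fun s hs => by
    have h1 : HasDerivWithinAt (fun s : ℝ => P.curve i 0 + s • u) u
        (Set.Icc 0 (P.length i)) s := by
      simpa using (((hasDerivAt_id s).smul_const u).const_add (P.curve i 0)).hasDerivWithinAt
    exact (h1.congr hu (hu s hs)).derivWithin (uniqueDiffOn_Icc (P.length_pos i) s hs)
  have h0 : (0 : ℝ) ∈ Set.Icc 0 (P.length i) := ⟨le_rfl, (P.length_pos i).le⟩
  refine ⟨u, ?_, hu, ht⟩
  rw [← ht 0 h0]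
  exact P.norm_tangent i h0

theorem IsStraight.curve_endParam {i : Fin n} (h : P.IsStraight i) (b : Bool) {r : ℝ}
    (hr : r ∈ Set.Icc 0 (P.length i)) :
    P.curve i (P.endParam i b r) = P.endPoint i b + r • P.endTangent i b := by
  obtain ⟨u, -, hu, ht⟩ := h.exists_tangent
  have hL : P.length i ∈ Set.Icc 0 (P.length i) := ⟨(P.length_pos i).le, le_rfl⟩
  have h0 : (0 : ℝ) ∈ Set.Icc 0 (P.length i) := ⟨le_rfl, (P.length_pos i).le⟩
  rw [hu _ (P.endParam_mem i b hr)]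
  cases b
  · simp [endParam, endPoint, endTangent, ht 0 h0]
  · simp only [endParam, endPoint, endTangent, ht _ hL, if_true, hu _ hL]
    module

theorem norm_endTangent (i : Fin n) (b : Bool) : ‖P.endTangent i b‖ = 1 := by
  have hL : P.length i ∈ Set.Icc 0 (P.length i) := ⟨(P.length_pos i).le, le_rfl⟩
  have h0 : (0 : ℝ) ∈ Set.Icc 0 (P.length i) := ⟨le_rfl, (P.length_pos i).le⟩
  cases b
  · simpa [endTangent] using P.norm_tangent i h0
  · simpa [endTangent] using P.norm_tangent i hL

/-- The traces of a cell function on two straight arcs that end at the same point coincide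
there. -/
theorem CellFunction.trace_end_eq (v : P.CellFunction) {i j : Fin n} {b c : Bool} {V : Plane}
    (hi : P.IsStraight i) (hj : P.IsStraight j) (hib : P.EndsAt i b V) (hjc : P.EndsAt j c V) :
    v.trace i (P.endParam i b 0) = v.trace j (P.endParam j c 0) := by
  obtain ⟨m, hm⟩ := hib
  obtain ⟨m', hm'⟩ := hjc
  obtain ⟨φ, hφ, -, hgrad, htrace⟩ := v.approx
  set δ := min (1 / 2) (min (P.length i) (P.length j)) with hδ
  have hδ0 : 0 < δ := lt_min (by norm_num) (lt_min (P.length_pos i) (P.length_pos j))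
  have hδ2 : δ ≤ 1 / 2 := min_le_left _ _
  have hδi : δ ≤ P.length i := (min_le_right _ _).trans (min_le_left _ _)
  have hδj : δ ≤ P.length j := (min_le_right _ _).trans (min_le_right _ _)
  have hmemi : ∀ r ∈ Set.Icc 0 δ, r ∈ Set.Icc 0 (P.length i) := fun r hr =>
    ⟨hr.1, hr.2.trans hδi⟩
  have hmemj : ∀ r ∈ Set.Icc 0 δ, r ∈ Set.Icc 0 (P.length j) := fun r hr =>
    ⟨hr.1, hr.2.trans hδj⟩
  -- Since the arcs are straight, near V they are rays, and the approximants do not see the lattice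
  -- translation.
  have hray : ∀ (k : ℕ) (l : Fin n) (d : Bool) (q : Fin 2 → ℤ), P.IsStraight l →
      V = P.endPoint l d + latticeVec q → ∀ r ∈ Set.Icc 0 (P.length l),
      φ k (V + r • P.endTangent l d) = φ k (P.curve l (P.endParam l d r)) := by
    intro k l d q hl hV r hr
    rw [hl.curve_endParam d hr, hV, add_right_comm, (hφ k).2]
  have hconti : ∀ (l : Fin n) (d : Bool), δ ≤ P.length l →
      ContinuousOn (fun r => v.trace l (P.endParam l d r)) (Set.Icc 0 δ) := fun l d hl =>
    (v.continuousOn_trace l).comp (P.continuous_endParam l d).continuousOn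
      fun r hr => P.endParam_mem l d ⟨hr.1, hr.2.trans hl⟩
  set A := eLpNorm v.grad 2 cellMeasure with hA
  have hAtop : A ≠ ⊤ := v.memLp_grad.eLpNorm_ne_top
  -- The bound `M` has the shape of the limit of the bounds for the approximants. Its last summand
  -- is zero: for fixed ε the errors of the traces carry the weight 1/ε, but they tend to 0 in L².
  have hzero := eq_zero_of_lintegral_inv_mul_le
    (h := fun r => v.trace i (P.endParam i b r) - v.trace j (P.endParam j c r)) hδ0
    ((hconti i b hδi).sub (hconti j c hδj))
    (M := 2 * (ENNReal.ofReal (2 * Real.pi) * (0 + A) ^ 2) +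
      4 * ENNReal.ofReal 1 * (0 ^ 2 + 0 ^ 2)) (by finiteness) ?_
  · exact sub_eq_zero.1 hzero
  intro ε hε
  set X : ℕ → ℝ → ℝ := fun k s => φ k (P.curve i s) - v.trace i s with hX
  set Y : ℕ → ℝ → ℝ := fun k s => φ k (P.curve j s) - v.trace j s with hY
  have hlim : Tendsto (fun k => 2 * (ENNReal.ofReal (2 * Real.pi) *
      (eLpNorm (fun x => gradient (φ k) x - v.grad x) 2 cellMeasure + A) ^ 2) +
      4 * ENNReal.ofReal ε⁻¹ * (eLpNorm (X k) 2 (P.arcMeasure i) ^ 2 +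
        eLpNorm (Y k) 2 (P.arcMeasure j) ^ 2)) atTop
      (𝓝 (2 * (ENNReal.ofReal (2 * Real.pi) * (0 + A) ^ 2) +
      4 * ENNReal.ofReal ε⁻¹ * (0 ^ 2 + 0 ^ 2))) := by
    refine Tendsto.add (ENNReal.Tendsto.const_mul (ENNReal.Tendsto.const_mul
      (ENNReal.Tendsto.pow (hgrad.add tendsto_const_nhds)) (Or.inr (by finiteness)))
        (Or.inr (by finiteness))) (ENNReal.Tendsto.const_mul (Tendsto.add
          (ENNReal.Tendsto.pow (htrace i)) (ENNReal.Tendsto.pow (htrace j)))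
            (Or.inr (by finiteness)))
  have hlim' : (4 * ENNReal.ofReal ε⁻¹ * (0 ^ 2 + 0 ^ 2) : ENNReal) =
      4 * ENNReal.ofReal 1 * (0 ^ 2 + 0 ^ 2) := by simp
  rw [hlim'] at hlim
  refine ge_of_tendsto' hlim fun k => ?_
  have hsm := (hφ k).1
  have hD : Measurable fun r : ℝ => ENNReal.ofReal r⁻¹ *
      ‖φ k (V + r • P.endTangent i b) - φ k (V + r • P.endTangent j c)‖ₑ ^ 2 := by
    refine Measurable.mul (ENNReal.measurable_ofReal.comp measurable_inv) ?_
    have : Continuous fun r : ℝ =>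
        φ k (V + r • P.endTangent i b) - φ k (V + r • P.endTangent j c) := by
      have := hsm.continuous
      fun_prop
    exact this.enorm.measurable.pow_const 2
  have hXc : ContinuousOn (fun r => X k (P.endParam i b r)) (Set.Ioo ε δ) := by
    have h1 : ContinuousOn (X k) (Set.Icc 0 (P.length i)) :=
      (hsm.continuous.comp_continuousOn (P.continuousOn_curve i)).sub (v.continuousOn_trace i)
    exact h1.comp (P.continuous_endParam i b).continuousOn fun r hr =>
      P.endParam_mem i b (hmemi r ⟨hε.1.le.trans hr.1.le, hr.2.le⟩)
  have hXm : AEMeasurable (fun r => ‖X k (P.endParam i b r)‖ₑ ^ 2)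
      (volume.restrict (Set.Ioo ε δ)) :=
    (hXc.aestronglyMeasurable measurableSet_Ioo).enorm.pow_const 2
  have hpt : ∀ r ∈ Set.Ioo ε δ, ENNReal.ofReal r⁻¹ *
      ‖v.trace i (P.endParam i b r) - v.trace j (P.endParam j c r)‖ₑ ^ 2 ≤
      2 * (ENNReal.ofReal r⁻¹ *
        ‖φ k (V + r • P.endTangent i b) - φ k (V + r • P.endTangent j c)‖ₑ ^ 2) +
      4 * ENNReal.ofReal ε⁻¹ * (‖X k (P.endParam i b r)‖ₑ ^ 2 + ‖Y k (P.endParam j c r)‖ₑ ^ 2) := by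
    intro r hr
    have hr' : r ∈ Set.Icc 0 δ := ⟨hε.1.le.trans hr.1.le, hr.2.le⟩
    set D := φ k (V + r • P.endTangent i b) - φ k (V + r • P.endTangent j c) with hDdef
    -- The difference of the traces is the difference of the smooth approximant along the two rays
    -- plus the two approximation errors.
    have hdecomp : v.trace i (P.endParam i b r) - v.trace j (P.endParam j c r) =
        D + (Y k (P.endParam j c r) + -X k (P.endParam i b r)) := by
      rw [hDdef, hray k i b m hi hm r (hmemi r hr'), hray k j c m' hj hm' r (hmemj r hr')]
      simp only [hX, hY]
      ring
    have h1 := enorm_add_sq_le D (Y k (P.endParam j c r) + -X k (P.endParam i b r))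
    have h2 := enorm_add_sq_le (Y k (P.endParam j c r)) (-X k (P.endParam i b r))
    rw [enorm_neg] at h2
    rw [hdecomp]
    have h3 : ENNReal.ofReal r⁻¹ ≤ ENNReal.ofReal ε⁻¹ :=
      ENNReal.ofReal_le_ofReal (inv_anti₀ hε.1 hr.1.le)
    calc _ ≤ ENNReal.ofReal r⁻¹ * (2 * (‖D‖ₑ ^ 2 + 2 * (‖Y k (P.endParam j c r)‖ₑ ^ 2 +
          ‖X k (P.endParam i b r)‖ₑ ^ 2))) := by
          gcongr
          exact h1.trans (by gcongr)
      _ = 2 * (ENNReal.ofReal r⁻¹ * ‖D‖ₑ ^ 2) + 4 * ENNReal.ofReal r⁻¹ *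
          (‖X k (P.endParam i b r)‖ₑ ^ 2 + ‖Y k (P.endParam j c r)‖ₑ ^ 2) := by ring
      _ ≤ _ := by gcongr
  refine (setLIntegral_mono' measurableSet_Ioo hpt).trans ?_
  rw [lintegral_add_left (hD.const_mul 2), lintegral_const_mul _ hD,
    lintegral_const_mul' _ _ (by finiteness), lintegral_add_left' hXm]
  have h1 := lintegral_ray_sub_sq_le hsm (hφ k).2 V hδ2 (P.norm_endTangent i b)
    (P.norm_endTangent j c)
  have h2 : ∫⁻ z in unitCell, ‖gradient (φ k) z‖ₑ ^ 2 ≤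
      (eLpNorm (fun x => gradient (φ k) x - v.grad x) 2 cellMeasure + A) ^ 2 := by
    rw [← eLpNorm_two_sq]
    gcongr
    have h3 := eLpNorm_add_le (μ := cellMeasure) (p := 2)
      (f := fun x => gradient (φ k) x - v.grad x) (g := v.grad)
      ((continuous_gradient hsm).aestronglyMeasurable.sub v.memLp_grad.aestronglyMeasurable)
      v.memLp_grad.aestronglyMeasurable (by norm_num)
    have h4 : (fun x => gradient (φ k) x - v.grad x) + v.grad = gradient (φ k) := by
      funext x
      simp
    rwa [h4] at h3
  have h3 : ∫⁻ r in Set.Ioo ε δ, ENNReal.ofReal r⁻¹ *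
      ‖φ k (V + r • P.endTangent i b) - φ k (V + r • P.endTangent j c)‖ₑ ^ 2 ≤
      ENNReal.ofReal (2 * Real.pi) *
      (eLpNorm (fun x => gradient (φ k) x - v.grad x) 2 cellMeasure + A) ^ 2 :=
    (lintegral_mono_set (Set.Ioo_subset_Ioo_left hε.1.le)).trans
      (h1.trans (mul_le_mul' le_rfl h2))
  have h4 := P.lintegral_comp_endParam_le i b hε.1.le hδi (fun s => ‖X k s‖ₑ ^ 2)
  have h5 := P.lintegral_comp_endParam_le j c hε.1.le hδj (fun s => ‖Y k s‖ₑ ^ 2)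
  rw [eLpNorm_two_sq, eLpNorm_two_sq]
  gcongr

end PeriodicPattern

/-! ### Smooth test functions and integration by parts along the arcs -/

theorem gradient_sub_const {φ : Plane → ℝ} (c : ℝ) (x : Plane) :
    gradient (fun y => φ y - c) x = gradient φ x := by
  unfold gradient
  rw [fderiv_sub_const]

namespace PeriodicPattern

variable {n : ℕ} (P : PeriodicPattern n)

/-- The second derivative of the `i`-th curve with respect to arc length. -/
noncomputable def curvatureVec (i : Fin n) (s : ℝ) : Plane :=
  derivWithin (P.tangent i) (Set.Icc 0 (P.length i)) s

theorem contDiffOn_tangent (i : Fin n) : ContDiffOn ℝ 1 (P.tangent i) (Set.Icc 0 (P.length i)) :=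
  (P.contDiffOn_curve i).derivWithin (uniqueDiffOn_Icc (P.length_pos i)) (by norm_num)

theorem hasDerivWithinAt_tangent (i : Fin n) {s : ℝ} (hs : s ∈ Set.Icc 0 (P.length i)) :
    HasDerivWithinAt (P.tangent i) (P.curvatureVec i s) (Set.Icc 0 (P.length i)) s :=
  ((P.contDiffOn_tangent i).differentiableOn (by simp) s hs).hasDerivWithinAt

theorem continuousOn_curvatureVec (i : Fin n) :
    ContinuousOn (P.curvatureVec i) (Set.Icc 0 (P.length i)) :=
  (P.contDiffOn_tangent i).continuousOn_derivWithin (uniqueDiffOn_Icc (P.length_pos i)) (by simp)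

theorem hasDerivWithinAt_comp_curve {φ : Plane → ℝ} (hφ : ContDiff ℝ ∞ φ) (i : Fin n) {s : ℝ}
    (hs : s ∈ Set.Icc 0 (P.length i)) :
    HasDerivWithinAt (fun s => φ (P.curve i s)) (fderiv ℝ φ (P.curve i s) (P.tangent i s))
      (Set.Icc 0 (P.length i)) s :=
  (hφ.differentiable (by simp) (P.curve i s)).hasFDerivAt.comp_hasDerivWithinAt s
    (P.hasDerivWithinAt_curve i hs)

theorem continuousOn_fderiv_comp_curve {φ : Plane → ℝ} (hφ : ContDiff ℝ ∞ φ) (i : Fin n) :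
    ContinuousOn (fun s => fderiv ℝ φ (P.curve i s) (P.tangent i s)) (Set.Icc 0 (P.length i)) :=
  ((hφ.continuous_fderiv (by simp)).comp_continuousOn (P.continuousOn_curve i)).clm_apply
    (P.continuousOn_tangent i)

theorem integral_eq_sub_of_hasDerivWithinAt_Icc {f f' : ℝ → ℝ} {L s : ℝ}
    (hf : ∀ t ∈ Set.Icc 0 L, HasDerivWithinAt f (f' t) (Set.Icc 0 L) t)
    (hf' : ContinuousOn f' (Set.Icc 0 L)) (hs : s ∈ Set.Icc 0 L) :
    ∫ t in (0 : ℝ)..s, f' t = f s - f 0 := by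
  have hsub : Set.Icc 0 s ⊆ Set.Icc 0 L := Set.Icc_subset_Icc_right hs.2
  refine intervalIntegral.integral_eq_sub_of_hasDerivAt_of_le hs.1
    (fun t ht => ((hf t (hsub ht)).continuousWithinAt).mono hsub) (fun t ht => ?_) ?_
  · exact (hf t (hsub (Set.Ioo_subset_Icc_self ht))).hasDerivAt
      (Icc_mem_nhds ht.1 (ht.2.trans_le hs.2))
  · exact (hf'.mono hsub).intervalIntegrable_of_Icc hs.1

/-- A smooth periodic function, minus its mean value, as a cell function. -/
noncomputable def CellFunction.ofSmooth {φ : Plane → ℝ} (hφ : ContDiff ℝ ∞ φ)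
    (hp : IsOnePeriodic φ) : P.CellFunction where
  val := fun x => φ x - ∫ y in unitCell, φ y
  grad := gradient φ
  trace := fun i s => φ (P.curve i s) - ∫ y in unitCell, φ y
  traceDeriv := fun i s => fderiv ℝ φ (P.curve i s) (P.tangent i s)
  memLp_val := (hφ.continuous.sub continuous_const).memLp_unitCell 2
  memLp_grad := (continuous_gradient hφ).memLp_unitCell 2
  approx := by
    refine ⟨fun _ x => φ x - ∫ y in unitCell, φ y, fun _ => ⟨hφ.sub contDiff_const, fun m x => ?_⟩,
      ?_, ?_, fun i => ?_⟩
    · simp [hp m x]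
    · simp
    · simp [gradient_sub_const]
    · simp
  memLp_traceDeriv := fun i => (P.continuousOn_fderiv_comp_curve hφ i).memLp_restrict_of_isCompact
    isCompact_Icc measurableSet_Icc 2
  trace_eq := fun i s hs => by
    rw [integral_eq_sub_of_hasDerivWithinAt_Icc
      (fun t ht => P.hasDerivWithinAt_comp_curve hφ i ht)
      (P.continuousOn_fderiv_comp_curve hφ i) hs]
    ring
  mean_zero := by
    rw [integral_sub ((hφ.continuous.memLp_unitCell 2).integrable (by norm_num))
      (integrable_const _)]
    simp

/-- The pattern exerts no net pull on any cell function. -/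
def IsCritical : Prop :=
  ∀ (v : P.CellFunction) (k : Fin 2), pull k v = 0

theorem integral_tangent_mul_fderiv {φ : Plane → ℝ} (hφ : ContDiff ℝ ∞ φ) (i : Fin n) (k : Fin 2) :
    ∫ s in (0 : ℝ)..P.length i, P.tangent i s k * fderiv ℝ φ (P.curve i s) (P.tangent i s) =
      P.tangent i (P.length i) k * φ (P.curve i (P.length i)) -
        P.tangent i 0 k * φ (P.curve i 0) -
      ∫ s in (0 : ℝ)..P.length i, P.curvatureVec i s k * φ (P.curve i s) := by
  have hL : P.length i ∈ Set.Icc 0 (P.length i) := ⟨(P.length_pos i).le, le_rfl⟩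
  have hproj : Continuous fun z : Plane => z k := by fun_prop
  have hτ : ContinuousOn (fun s => P.tangent i s k) (Set.Icc 0 (P.length i)) :=
    hproj.comp_continuousOn (P.continuousOn_tangent i)
  have hκ : ContinuousOn (fun s => P.curvatureVec i s k) (Set.Icc 0 (P.length i)) :=
    hproj.comp_continuousOn (P.continuousOn_curvatureVec i)
  have hc1 : ContinuousOn (fun s => P.curvatureVec i s k * φ (P.curve i s))
      (Set.Icc 0 (P.length i)) :=
    hκ.mul (hφ.continuous.comp_continuousOn (P.continuousOn_curve i))
  have hc2 : ContinuousOn (fun s => P.tangent i s k *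
      fderiv ℝ φ (P.curve i s) (P.tangent i s)) (Set.Icc 0 (P.length i)) :=
    hτ.mul (P.continuousOn_fderiv_comp_curve hφ i)
  have hd : ∀ s ∈ Set.Icc 0 (P.length i), HasDerivWithinAt
      (fun s => P.tangent i s k * φ (P.curve i s))
      (P.curvatureVec i s k * φ (P.curve i s) +
        P.tangent i s k * fderiv ℝ φ (P.curve i s) (P.tangent i s))
      (Set.Icc 0 (P.length i)) s := fun s hs => by
    have h1 : HasDerivWithinAt (fun s => P.tangent i s k) (P.curvatureVec i s k)
        (Set.Icc 0 (P.length i)) s :=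
      (EuclideanSpace.proj k : Plane →L[ℝ] ℝ).hasFDerivAt.comp_hasDerivWithinAt s
        (P.hasDerivWithinAt_tangent i hs)
    exact h1.mul (P.hasDerivWithinAt_comp_curve hφ i hs)
  have h := integral_eq_sub_of_hasDerivWithinAt_Icc hd (hc1.add hc2) hL
  rw [intervalIntegral.integral_add (hc1.intervalIntegrable_of_Icc hL.1)
    (hc2.intervalIntegrable_of_Icc hL.1)] at h
  linarith

variable {P}

/-- This is the first variation formula for length, with end point terms and curvature terms
separated so that each can be isolated by a bump. Subtracting the mean of φ to get an admissible
function does not change its derivatives. -/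
theorem IsCritical.sum_eq_zero (h : P.IsCritical) {φ : Plane → ℝ} (hφ : ContDiff ℝ ∞ φ)
    (hp : IsOnePeriodic φ) (k : Fin 2) :
    ∑ i, (P.tangent i (P.length i) k * φ (P.curve i (P.length i)) -
        P.tangent i 0 k * φ (P.curve i 0) -
      ∫ s in (0 : ℝ)..P.length i, P.curvatureVec i s k * φ (P.curve i s)) = 0 := by
  refine Eq.trans ?_ (h (CellFunction.ofSmooth P hφ hp) k)
  exact Finset.sum_congr rfl fun i _ => (P.integral_tangent_mul_fderiv hφ i k).symm

end PeriodicPattern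

/-! ### Periodic bump functions -/

/-- A periodic function that measures the distance to the translates of `a` by the lattice. -/
noncomputable def latticeGauge (a x : Plane) : ℝ :=
  ∑ i, (1 - Real.cos (2 * Real.pi * (x i - a i)))

theorem contDiff_latticeGauge (a : Plane) : ContDiff ℝ ∞ (latticeGauge a) := by
  unfold latticeGauge
  refine ContDiff.sum fun i _ => contDiff_const.sub (Real.contDiff_cos.comp ?_)
  have : ContDiff ℝ ∞ fun x : Plane => x i := (EuclideanSpace.proj i : Plane →L[ℝ] ℝ).contDiff
  exact contDiff_const.mul (this.sub contDiff_const)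

theorem latticeGauge_nonneg (a x : Plane) : 0 ≤ latticeGauge a x :=
  Finset.sum_nonneg fun _ _ => sub_nonneg.2 (Real.cos_le_one _)

theorem latticeGauge_add_latticeVec (a x : Plane) (m : Fin 2 → ℤ) :
    latticeGauge a (x + latticeVec m) = latticeGauge a x := by
  unfold latticeGauge
  refine Finset.sum_congr rfl fun i _ => ?_
  have : 2 * Real.pi * ((x + latticeVec m) i - a i) =
      2 * Real.pi * (x i - a i) + m i * (2 * Real.pi) := by
    simp only [PiLp.add_apply, latticeVec]
    ring
  rw [this, Real.cos_add_int_mul_two_pi]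

theorem latticeGauge_self (a : Plane) : latticeGauge a a = 0 := by simp [latticeGauge]

theorem exists_of_latticeGauge_eq_zero {a x : Plane} (h : latticeGauge a x = 0) :
    ∃ m : Fin 2 → ℤ, x = a + latticeVec m := by
  have h1 := (Finset.sum_eq_zero_iff_of_nonneg
    (fun i _ => sub_nonneg.2 (Real.cos_le_one (2 * Real.pi * (x i - a i))))).1 h
  have h2 : ∀ i, ∃ m : ℤ, x i - a i = m := fun i => by
    obtain ⟨m, hm⟩ := (Real.cos_eq_one_iff _).1 (sub_eq_zero.1 (h1 i (Finset.mem_univ i))).symm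
    refine ⟨m, ?_⟩
    have hpi := Real.pi_pos
    have : 2 * Real.pi * (x i - a i) = 2 * Real.pi * m := by linarith
    exact mul_left_cancel₀ (by positivity) this
  choose m hm using h2
  refine ⟨m, ?_⟩
  ext i
  have := hm i
  simp only [PiLp.add_apply, latticeVec]
  linarith

/-- A smooth periodic bump function, concentrated near the translates of `a` by the lattice. -/
noncomputable def periodicBump (a : Plane) (ε : ℝ) (x : Plane) : ℝ :=
  Real.smoothTransition (1 - latticeGauge a x / ε)

theorem contDiff_periodicBump (a : Plane) (ε : ℝ) : ContDiff ℝ ∞ (periodicBump a ε) :=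
  Real.smoothTransition.contDiff.comp (contDiff_const.sub ((contDiff_latticeGauge a).div_const ε))

theorem isOnePeriodic_periodicBump (a : Plane) (ε : ℝ) : IsOnePeriodic (periodicBump a ε) :=
  fun m x => by simp only [periodicBump, latticeGauge_add_latticeVec]

theorem periodicBump_self (a : Plane) (ε : ℝ) : periodicBump a ε a = 1 := by
  simp [periodicBump, latticeGauge_self]

theorem periodicBump_nonneg (a : Plane) (ε : ℝ) (x : Plane) : 0 ≤ periodicBump a ε x :=
  Real.smoothTransition.nonneg _

theorem periodicBump_eq_zero {a x : Plane} {ε : ℝ} (hε : 0 < ε) (h : ε ≤ latticeGauge a x) :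
    periodicBump a ε x = 0 :=
  Real.smoothTransition.zero_of_nonpos (sub_nonpos.2 ((one_le_div hε).2 h))

/-- A positive lower bound of the gauge on a compact part of a curve that avoids the lattice
translates of `a`. -/
theorem exists_le_latticeGauge {a : Plane} {γ : ℝ → Plane} {K : Set ℝ} (hK : IsCompact K)
    (hγ : ContinuousOn γ K) (hne : ∀ s ∈ K, ∀ m : Fin 2 → ℤ, γ s ≠ a + latticeVec m) :
    ∃ ε > 0, ∀ s ∈ K, ε ≤ latticeGauge a (γ s) := by
  rcases K.eq_empty_or_nonempty with rfl | hne'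
  · exact ⟨1, one_pos, by simp⟩
  obtain ⟨s, hs, hmin⟩ := hK.exists_isMinOn hne'
    ((contDiff_latticeGauge a).continuous.comp_continuousOn hγ)
  refine ⟨latticeGauge a (γ s), lt_of_le_of_ne (latticeGauge_nonneg _ _) fun h => ?_, hmin⟩
  obtain ⟨m, hm⟩ := exists_of_latticeGauge_eq_zero h.symm
  exact hne s hs m hm

theorem exists_pos_le_of_finite {ι : Type*} [Finite ι] {f : ι → ℝ} (hf : ∀ i, 0 < f i) :
    ∃ ε > 0, ∀ i, ε ≤ f i := by
  cases isEmpty_or_nonempty ι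
  · exact ⟨1, one_pos, fun i => isEmptyElim i⟩
  · obtain ⟨i, hi⟩ := Finite.exists_min f
    exact ⟨f i, hf i, hi⟩

/-! ### Critical patterns have straight arcs -/

namespace PeriodicPattern

variable {n : ℕ} {P : PeriodicPattern n}

/-- If a component of the curvature were nonzero at an interior point, it would keep its sign
nearby. A bump concentrated there meets no other arc and no end point, so the first variation
formula would reduce to one curvature integral of strict sign. -/
theorem IsCritical.curvatureVec_eq_zero (h : P.IsCritical) (i : Fin n) {s₀ : ℝ}
    (hs₀ : s₀ ∈ Set.Ioo 0 (P.length i)) : P.curvatureVec i s₀ = 0 := by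
  ext k
  by_contra hne
  change P.curvatureVec i s₀ k ≠ 0 at hne
  have hs₀' : s₀ ∈ Set.Icc 0 (P.length i) := Set.Ioo_subset_Icc_self hs₀
  have hκ : ContinuousOn (fun s => P.curvatureVec i s k) (Set.Icc 0 (P.length i)) :=
    (by fun_prop : Continuous fun z : Plane => z k).comp_continuousOn
      (P.continuousOn_curvatureVec i)
  have hpos : ∀ᶠ s in 𝓝 s₀, s ∈ Set.Ioo 0 (P.length i) ∧
      0 < P.curvatureVec i s₀ k * P.curvatureVec i s k := by
    refine (isOpen_Ioo.eventually_mem hs₀).and ?_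
    have hc : ContinuousAt (fun s => P.curvatureVec i s₀ k * P.curvatureVec i s k) s₀ :=
      continuousAt_const.mul (hκ.continuousAt (Icc_mem_nhds hs₀.1 hs₀.2))
    exact hc.eventually (lt_mem_nhds (mul_self_pos.2 hne))
  obtain ⟨η, hη, hball⟩ := Metric.eventually_nhds_iff_ball.1 hpos
  -- The part of arc `j` where the bump must vanish: all of it if `j ≠ i`, and the complement of the
  -- chosen neighbourhood of `s₀` if `j = i`. All end points belong to it.
  set K : Fin n → Set ℝ := fun j => Set.Icc 0 (P.length j) ∩ {s | j = i → s ∉ Metric.ball s₀ η}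
    with hK
  have hKc : ∀ j, IsCompact (K j) := fun j => by
    refine isCompact_Icc.inter_right ?_
    by_cases hj : j = i
    · have : {s | j = i → s ∉ Metric.ball s₀ η} = (Metric.ball s₀ η)ᶜ := by
        ext
        simp [hj]
      rw [this]
      exact Metric.isOpen_ball.isClosed_compl
    · simp [hj]
  have hex : ∀ j, ∃ ε > 0, ∀ s ∈ K j, ε ≤ latticeGauge (P.curve i s₀) (P.curve j s) := fun j => by
    refine exists_le_latticeGauge (hKc j) ((P.continuousOn_curve j).mono Set.inter_subset_left)
      fun s hs m hm => ?_
    -- As `s₀` is an interior parameter, the point can be hit in the torus only by arc `i` itself at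
    -- `s₀`, which `K i` excludes.
    rcases P.meet_at_ends j i m s hs.1 s₀ hs₀' hm with ⟨hji, rfl⟩ | ⟨-, h0 | h0⟩
    · exact hs.2 hji (Metric.mem_ball_self hη)
    · exact hs₀.1.ne' h0
    · exact hs₀.2.ne h0
  choose e he hle using hex
  obtain ⟨ε, hε, hεle⟩ := exists_pos_le_of_finite he
  set φ := periodicBump (P.curve i s₀) ε with hφ
  have hzero : ∀ j, ∀ s ∈ K j, φ (P.curve j s) = 0 := fun j s hs =>
    periodicBump_eq_zero hε ((hεle j).trans (hle j s hs))
  have hend : ∀ j s, (s = 0 ∨ s = P.length j) → s ∈ K j := by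
    intro j s hs
    have hL := (P.length_pos j).le
    refine ⟨?_, ?_⟩
    · rcases hs with rfl | rfl
      · exact ⟨le_rfl, hL⟩
      · exact ⟨hL, le_rfl⟩
    · rintro rfl hs'
      have := (hball s hs').1
      rcases hs with rfl | rfl
      · exact this.1.ne rfl
      · exact this.2.ne rfl
  have hsum := h.sum_eq_zero (contDiff_periodicBump (P.curve i s₀) ε)
    (isOnePeriodic_periodicBump _ _) k
  rw [← hφ] at hsum
  have hbd : ∀ j, P.tangent j (P.length j) k * φ (P.curve j (P.length j)) -
        P.tangent j 0 k * φ (P.curve j 0) -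
      (∫ s in (0 : ℝ)..P.length j, P.curvatureVec j s k * φ (P.curve j s)) =
      -∫ s in (0 : ℝ)..P.length j, P.curvatureVec j s k * φ (P.curve j s) := fun j => by
    rw [hzero j _ (hend j _ (Or.inr rfl)), hzero j _ (hend j _ (Or.inl rfl))]
    ring
  simp_rw [hbd] at hsum
  rw [Finset.sum_eq_single i] at hsum
  · have hintpos : 0 < ∫ s in (0 : ℝ)..P.length i,
        P.curvatureVec i s₀ k * (P.curvatureVec i s k * φ (P.curve i s)) := by
      refine intervalIntegral.integral_pos (P.length_pos i) ?_ (fun s hs => ?_) ⟨s₀, hs₀', ?_⟩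
      · exact continuousOn_const.mul (hκ.mul
          ((contDiff_periodicBump _ ε).continuous.comp_continuousOn (P.continuousOn_curve i)))
      · by_cases hs' : s ∈ Metric.ball s₀ η
        · rw [← mul_assoc]
          exact mul_nonneg (hball s hs').2.le (periodicBump_nonneg _ _ _)
        · rw [hzero i s ⟨⟨hs.1.le, hs.2⟩, fun _ => hs'⟩]
          simp
      · rw [hφ, periodicBump_self, mul_one]
        exact mul_self_pos.2 hne
    rw [intervalIntegral.integral_const_mul, neg_eq_zero.1 hsum, mul_zero] at hintpos
    exact lt_irrefl _ hintpos
  · intro j _ hj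
    rw [neg_eq_zero]
    refine intervalIntegral.integral_zero_ae (Eventually.of_forall fun s hs => ?_)
    rw [Set.uIoc_of_le (P.length_pos j).le] at hs
    rw [hzero j s ⟨⟨hs.1.le, hs.2⟩, fun h => absurd h hj⟩, mul_zero]
  · simp

theorem IsCritical.isStraight (h : P.IsCritical) (i : Fin n) : P.IsStraight i := by
  have hκ : ∀ s ∈ Set.Icc 0 (P.length i), P.curvatureVec i s = 0 := by
    have h1 : Set.EqOn (P.curvatureVec i) (fun _ => 0) (Set.Ioo 0 (P.length i)) :=
      fun s hs => h.curvatureVec_eq_zero i hs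
    refine h1.of_subset_closure (P.continuousOn_curvatureVec i) continuousOn_const
      Set.Ioo_subset_Icc_self ?_
    rw [closure_Ioo (P.length_pos i).ne]
  have hτ : ∀ s ∈ Set.Icc 0 (P.length i), P.tangent i s = P.tangent i 0 :=
    constant_of_derivWithin_zero ((P.contDiffOn_tangent i).differentiableOn (by simp))
      fun s hs => hκ s (Set.Ico_subset_Icc_self hs)
  refine ⟨P.tangent i 0, fun s hs => ?_⟩
  have hd : ∀ s ∈ Set.Icc 0 (P.length i),
      HasDerivWithinAt (fun s => P.curve i s - s • P.tangent i 0) 0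
        (Set.Icc 0 (P.length i)) s := fun s hs => by
    have h2 : HasDerivWithinAt (fun s : ℝ => s • P.tangent i 0) (P.tangent i 0)
        (Set.Icc 0 (P.length i)) s := by
      simpa using ((hasDerivAt_id s).smul_const (P.tangent i 0)).hasDerivWithinAt
    have h1 := (P.hasDerivWithinAt_curve i hs).sub h2
    rwa [hτ s hs, sub_self] at h1
  have h3 := constant_of_derivWithin_zero (fun s hs => (hd s hs).differentiableWithinAt)
    (fun s hs => (hd s (Set.Ico_subset_Icc_self hs)).derivWithin
      (uniqueDiffOn_Icc (P.length_pos i) s (Set.Ico_subset_Icc_self hs))) s hs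
  simp only [zero_smul, sub_zero] at h3
  rw [← h3]
  abel

end PeriodicPattern

/-! ### Balance at the ends of arcs: critical means balanced -/

theorem latticeVec_zero : latticeVec 0 = 0 := by
  ext i
  simp [latticeVec]

theorem latticeVec_neg (m : Fin 2 → ℤ) : latticeVec (-m) = -latticeVec m := by
  ext i
  simp [latticeVec]

theorem latticeVec_sub (m m' : Fin 2 → ℤ) : latticeVec (m - m') = latticeVec m - latticeVec m' := by
  ext i
  simp [latticeVec]

namespace PeriodicPattern

variable {n : ℕ} {P : PeriodicPattern n}

open Classical in
/-- The sum of the inward unit tangent vectors at the ends of arcs that lie at `V`. -/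
noncomputable def tangentSum (P : PeriodicPattern n) (V : Plane) : Plane :=
  ∑ i : Fin n, ∑ b : Bool, if P.EndsAt i b V then P.endTangent i b else 0

theorem IsStraight.endPoint_sub {i : Fin n} (h : P.IsStraight i) (b : Bool) :
    P.endPoint i b - P.endPoint i (!b) = -(P.length i • P.endTangent i b) := by
  have h1 := h.curve_endParam b (r := P.length i) ⟨(P.length_pos i).le, le_rfl⟩
  have h2 : P.curve i (P.endParam i b (P.length i)) = P.endPoint i (!b) := by
    cases b <;> simp [endParam, endPoint]
  rw [← h2, h1]
  abel

theorem balanceSum_eq_neg (h : ∀ i, P.IsStraight i) (V : Plane) :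
    P.balanceSum V = -P.tangentSum V := by
  unfold balanceSum tangentSum
  rw [← Finset.sum_neg_distrib]
  refine Finset.sum_congr rfl fun i _ => ?_
  rw [← Finset.sum_neg_distrib]
  refine Finset.sum_congr rfl fun b _ => ?_
  split_ifs
  · have hL := P.length_pos i
    rw [(h i).endPoint_sub b, norm_neg, norm_smul, P.norm_endTangent, mul_one,
      Real.norm_of_nonneg hL.le, smul_neg, smul_smul, inv_mul_cancel₀ hL.ne', one_smul]
  · simp

/-- The bump at V is so small that it vanishes at every end not lying over V and equals 1 at the
others. The curvature integrals are already known to vanish, so only the tangents at V remain. -/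
theorem IsCritical.tangentSum_eq_zero (h : P.IsCritical) (V : Plane) : P.tangentSum V = 0 := by
  classical
  have hex : ∀ p : Fin n × Bool, ∃ ε > 0, ¬ P.EndsAt p.1 p.2 V →
      ε ≤ latticeGauge V (P.endPoint p.1 p.2) := fun p => by
    by_cases hp : P.EndsAt p.1 p.2 V
    · exact ⟨1, one_pos, fun h' => absurd hp h'⟩
    · refine ⟨_, lt_of_le_of_ne (latticeGauge_nonneg V (P.endPoint p.1 p.2)) fun h0 => hp ?_,
        fun _ => le_rfl⟩
      obtain ⟨m, hm⟩ := exists_of_latticeGauge_eq_zero h0.symm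
      exact ⟨-m, by rw [hm, latticeVec_neg]; abel⟩
  choose e he hle using hex
  obtain ⟨ε, hε, hεle⟩ := exists_pos_le_of_finite he
  set φ := periodicBump V ε with hφ
  have hval : ∀ i b, φ (P.endPoint i b) = if P.EndsAt i b V then 1 else 0 := fun i b => by
    split_ifs with hib
    · obtain ⟨m, hm⟩ := hib
      rw [hφ, ← isOnePeriodic_periodicBump V ε m (P.endPoint i b), ← hm, periodicBump_self]
    · exact periodicBump_eq_zero hε ((hεle (i, b)).trans (hle (i, b) hib))
  ext k
  have hsum := h.sum_eq_zero (contDiff_periodicBump V ε) (isOnePeriodic_periodicBump V ε) k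
  rw [← hφ] at hsum
  have hcurv : ∀ i, ∫ s in (0 : ℝ)..P.length i, P.curvatureVec i s k * φ (P.curve i s) = 0 :=
    fun i => by
      rw [intervalIntegral.integral_of_le (P.length_pos i).le, integral_Ioc_eq_integral_Ioo]
      refine setIntegral_eq_zero_of_forall_eq_zero fun s hs => ?_
      rw [h.curvatureVec_eq_zero i hs]
      simp
  simp_rw [hcurv, sub_zero] at hsum
  have hterm : ∀ i, P.tangent i (P.length i) k * φ (P.curve i (P.length i)) -
      P.tangent i 0 k * φ (P.curve i 0) =
      -((∑ b : Bool, if P.EndsAt i b V then P.endTangent i b else 0 : Plane) k) := fun i => by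
    have h1 := hval i true
    have h0 := hval i false
    simp only [endPoint, if_true, Bool.false_eq_true, if_false] at h1 h0
    rw [h1, h0, Fintype.sum_bool]
    simp only [endTangent, if_true, Bool.false_eq_true, if_false]
    split_ifs <;> simp <;> ring
  simp_rw [hterm] at hsum
  rw [Finset.sum_neg_distrib, neg_eq_zero] at hsum
  simpa [tangentSum] using hsum

theorem IsCritical.isBalanced (h : P.IsCritical) : P.IsBalanced := by
  classical
  refine ⟨h.isStraight, fun V hV => ?_, fun V _ => by
    rw [balanceSum_eq_neg h.isStraight, h.tangentSum_eq_zero, neg_zero]⟩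
  obtain ⟨⟨i, b, hib⟩, -⟩ := hV
  -- With a single end at V the vanishing sum would be one unit vector.
  obtain ⟨j, c, hjc, hne⟩ : ∃ j c, P.EndsAt j c V ∧ (j, c) ≠ (i, b) := by
    by_contra! hall
    have hsum := h.tangentSum_eq_zero V
    unfold tangentSum at hsum
    rw [← Fintype.sum_prod_type' (f := fun (i : Fin n) (b : Bool) =>
      if P.EndsAt i b V then P.endTangent i b else 0), Finset.sum_eq_single (i, b), if_pos hib] at hsum
    · have := P.norm_endTangent i b
      rw [hsum, norm_zero] at this
      exact zero_ne_one this
    · rintro ⟨j, c⟩ - hne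
      exact if_neg fun hjc => hne (hall j c hjc)
    · simp
  obtain ⟨m, hm⟩ := hib
  obtain ⟨m', hm'⟩ := hjc
  refine ⟨(i, m), (j, m'), fun heq => ?_, ⟨b, hm⟩, ⟨c, hm'⟩⟩
  obtain ⟨rfl, rfl⟩ := Prod.mk.inj heq
  -- Two different ends on the same translated arc are its two ends. They would coincide in the
  -- plane, which a straight arc of positive length does not allow.
  have hcb : c = !b := by
    cases b <;> cases c <;> simp_all
  subst hcb
  have h1 : P.endPoint i b - P.endPoint i (!b) = 0 := by
    rw [sub_eq_zero]
    exact add_right_cancel (hm.symm.trans hm')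
  rw [(h.isStraight i).endPoint_sub b, neg_eq_zero, smul_eq_zero] at h1
  rcases h1 with h1 | h1
  · exact (P.length_pos i).ne' h1
  · have := P.norm_endTangent i b
    rw [h1, norm_zero] at this
    exact zero_ne_one this

/-- An end that is not a node is the base point of a smooth closed curve, where the two ends leave
in opposite directions and cancel. So the sum vanishes at every end of an arc, node or not. -/
theorem IsBalanced.tangentSum_eq_zero (h : P.IsBalanced) {V : Plane}
    (hV : ∃ i b, P.EndsAt i b V) : P.tangentSum V = 0 := by
  classical
  by_cases hnode : P.IsNode V
  · have := h.2.2 V hnode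
    rwa [balanceSum_eq_neg h.1, neg_eq_zero] at this
  · obtain ⟨i, ⟨⟨m, hm⟩, htan, -⟩, ⟨m', hm'⟩, hall⟩ : ∃ i, P.IsSmoothClosed i ∧
        P.EndsAt i false V ∧ ∀ j c, P.EndsAt j c V → j = i := by
      by_contra hno
      exact hnode ⟨hV, hno⟩
    have hfalse : P.EndsAt i false V := ⟨m', hm'⟩
    have htrue : P.EndsAt i true V := by
      refine ⟨m' - m, ?_⟩
      rw [hm', latticeVec_sub]
      simp only [endPoint, if_true, Bool.false_eq_true, if_false, hm]
      abel
    unfold tangentSum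
    rw [Finset.sum_eq_single i]
    · rw [Fintype.sum_bool, if_pos hfalse, if_pos htrue]
      simp [endTangent, htan]
    · intro j _ hj
      refine Finset.sum_eq_zero fun c _ => if_neg fun hc => hj (hall j c hc)
    · simp

/-- Two ends of arcs are equivalent if they lie at the same point of the torus. -/
def endSetoid (P : PeriodicPattern n) : Setoid (Fin n × Bool) where
  r p q := P.EndsAt p.1 p.2 (P.endPoint q.1 q.2)
  iseqv :=
    { refl := fun p => ⟨0, by rw [latticeVec_zero, add_zero]⟩
      symm := by
        rintro p q ⟨m, hm⟩
        exact ⟨-m, by rw [hm, latticeVec_neg]; abel⟩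
      trans := by
        rintro p q r ⟨m, hm⟩ ⟨m', hm'⟩
        refine ⟨m' - -m, ?_⟩
        rw [hm', hm, latticeVec_sub, latticeVec_neg]
        abel }

/-- On a straight arc the tangent is constant, so `pull` collapses to values of the traces at the
ends. Group the ends by their point in the torus: within a group the trace has one common value by
`CellFunction.trace_end_eq`, and it multiplies a vanishing sum of tangents. -/
theorem IsBalanced.isCritical (h : P.IsBalanced) : P.IsCritical := by
  classical
  intro v k
  have hterm : ∀ i, ∫ s in (0 : ℝ)..P.length i, P.tangent i s k * v.traceDeriv i s =
      ∑ b : Bool, -(P.endTangent i b k * v.trace i (P.endParam i b 0)) := fun i => by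
    obtain ⟨u, -, -, hu⟩ := (h.1 i).exists_tangent
    have hL : P.length i ∈ Set.Icc 0 (P.length i) := ⟨(P.length_pos i).le, le_rfl⟩
    have h0 : (0 : ℝ) ∈ Set.Icc 0 (P.length i) := ⟨le_rfl, (P.length_pos i).le⟩
    have h1 : ∫ s in (0 : ℝ)..P.length i, P.tangent i s k * v.traceDeriv i s =
        ∫ s in (0 : ℝ)..P.length i, u k * v.traceDeriv i s := by
      refine intervalIntegral.integral_congr fun s hs => ?_
      rw [Set.uIcc_of_le hL.1] at hs
      simp only [hu s hs]
    have h2 := v.trace_eq i _ hL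
    rw [h1, intervalIntegral.integral_const_mul, Fintype.sum_bool]
    simp only [endTangent, endParam, if_true, Bool.false_eq_true, if_false, hu _ hL, hu _ h0, h2,
      sub_zero, PiLp.neg_apply]
    ring
  unfold pull
  simp_rw [hterm]
  rw [← Fintype.sum_prod_type' (f := fun (i : Fin n) (b : Bool) =>
    -(P.endTangent i b k * v.trace i (P.endParam i b 0)))]
  refine Finset.sum_cancels_of_partition_cancels P.endSetoid fun q _ => ?_
  have hq : P.tangentSum (P.endPoint q.1 q.2) = 0 :=
    h.tangentSum_eq_zero ⟨q.1, q.2, P.endSetoid.refl q⟩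
  have hq' := congrArg (fun z : Plane => z k) hq
  unfold tangentSum at hq'
  rw [← Fintype.sum_prod_type' (f := fun (i : Fin n) (b : Bool) =>
    if P.EndsAt i b (P.endPoint q.1 q.2) then P.endTangent i b else 0), ← Finset.sum_filter] at hq'
  have hcongr : ∀ p ∈ Finset.univ.filter fun p : Fin n × Bool => P.endSetoid p q,
      -(P.endTangent p.1 p.2 k * v.trace p.1 (P.endParam p.1 p.2 0)) =
      -(P.endTangent p.1 p.2 k * v.trace q.1 (P.endParam q.1 q.2 0)) := fun p hp => by
    rw [v.trace_end_eq (h.1 p.1) (h.1 q.1) (Finset.mem_filter.1 hp).2 (P.endSetoid.refl q)]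
  refine (Finset.sum_congr rfl hcongr).trans ?_
  rw [Finset.sum_neg_distrib, ← Finset.sum_mul, neg_eq_zero]
  refine mul_eq_zero_of_left ?_ _
  rw [WithLp.ofLp_sum, Finset.sum_apply] at hq'
  exact hq'

theorem isBalanced_iff_isCritical : P.IsBalanced ↔ P.IsCritical :=
  ⟨IsBalanced.isCritical, IsCritical.isBalanced⟩

/-! ### Uniqueness of the tensor and the energy identity for its trace -/

theorem dirichletForm_self_nonneg {a : ℝ} (ha : 0 ≤ a) (w : P.CellFunction) :
    0 ≤ dirichletForm a w w := by
  rw [← inner_energyMap_tuple ha]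
  exact real_inner_self_nonneg

/-- Testing both equations with both correctors shows that their difference has zero energy. Only
the derivatives along the arcs enter the tensor, so this is the uniqueness it needs. -/
theorem IsCorrector.traceDeriv_ae_eq {a : ℝ} (ha : 0 < a) {k : Fin 2} {w w' : P.CellFunction}
    (hw : P.IsCorrector a k w) (hw' : P.IsCorrector a k w') (i : Fin n) :
    w.traceDeriv i =ᵐ[P.arcMeasure i] w'.traceDeriv i := by
  have h1 := isCorrector_iff.1 hw w
  have h2 := isCorrector_iff.1 hw w'
  have h3 := isCorrector_iff.1 hw' w
  have h4 := isCorrector_iff.1 hw' w'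
  simp only [← inner_energyMap_tuple ha.le] at h1 h2 h3 h4
  have h5 : inner ℝ (P.energyMap a w.tuple - P.energyMap a w'.tuple)
      (P.energyMap a w.tuple - P.energyMap a w'.tuple) = 0 := by
    rw [inner_sub_left, inner_sub_right, inner_sub_right]
    linarith
  have h6 : P.energyMap a w.tuple = P.energyMap a w'.tuple :=
    sub_eq_zero.1 (inner_self_eq_zero.1 h5)
  have h7 : √a • w.tuple.2 i = √a • w'.tuple.2 i := by
    rw [← energyMap_snd, ← energyMap_snd, h6]
  have h8 : w.tuple.2 i = w'.tuple.2 i := smul_right_injective _ (Real.sqrt_pos.2 ha).ne' h7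
  have h9 := MemLp.coeFn_toLp (w.memLp_traceDeriv i)
  have h10 := MemLp.coeFn_toLp (w'.memLp_traceDeriv i)
  refine h9.symm.trans (EventuallyEq.trans ?_ h10)
  change w.tuple.2 i =ᵐ[P.arcMeasure i] w'.tuple.2 i
  rw [h8]

theorem IsEffectiveTensor.unique {a : ℝ} (ha : 0 < a) {S S' : Matrix (Fin 2) (Fin 2) ℝ}
    (hS : P.IsEffectiveTensor a S) (hS' : P.IsEffectiveTensor a S') : S = S' := by
  obtain ⟨w, hw, hwS⟩ := hS
  obtain ⟨w', hw', hwS'⟩ := hS'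
  ext k l
  rw [hwS, hwS']
  congr 2
  refine Finset.sum_congr rfl fun i _ => ?_
  rw [P.intervalIntegral_eq_arcMeasure, P.intervalIntegral_eq_arcMeasure]
  refine integral_congr_ae ?_
  filter_upwards [(hw k).traceDeriv_ae_eq ha (hw' k) i] with s hs
  rw [hs]

/-- Testing the k-th equation with its own solution replaces a `pull k w_k` by minus the energy of
w_k. The remaining terms add up to the length because the tangents have norm one. -/
theorem trace_eq_sub_dirichletForm {a : ℝ} {w : Fin 2 → P.CellFunction}
    (hw : ∀ k, P.IsCorrector a k (w k)) {S : Matrix (Fin 2) (Fin 2) ℝ}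
    (hS : ∀ k l, S k l = (if k = l then 1 else 0) + a * ∑ i, ∫ s in (0 : ℝ)..P.length i,
      ((w k).traceDeriv i s + P.tangent i s k) * P.tangent i s l) :
    S.trace = 2 + a * P.totalLength - ∑ k, dirichletForm a (w k) (w k) := by
  have hint : ∀ k i, IntervalIntegrable (fun s => P.tangent i s k * (w k).traceDeriv i s) volume 0
      (P.length i) := fun k i =>
    (intervalIntegrable_iff_integrableOn_Icc_of_le (P.length_pos i).le).2
      ((P.memLp_tangent i k).integrable_mul ((w k).memLp_traceDeriv i))
  have hint2 : ∀ k i, IntervalIntegrable (fun s => P.tangent i s k * P.tangent i s k) volume 0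
      (P.length i) := fun k i =>
    (intervalIntegrable_iff_integrableOn_Icc_of_le (P.length_pos i).le).2
      ((P.memLp_tangent i k).integrable_mul (P.memLp_tangent i k))
  have hdiag : ∀ k, S k k = 1 - dirichletForm a (w k) (w k) +
      a * ∑ i, ∫ s in (0 : ℝ)..P.length i, P.tangent i s k * P.tangent i s k := fun k => by
    have h1 := isCorrector_iff.1 (hw k) (w k)
    have h2 : ∑ i, (∫ s in (0 : ℝ)..P.length i,
        ((w k).traceDeriv i s + P.tangent i s k) * P.tangent i s k) = pull k (w k) +
        ∑ i, ∫ s in (0 : ℝ)..P.length i, P.tangent i s k * P.tangent i s k := by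
      rw [pull, ← Finset.sum_add_distrib]
      refine Finset.sum_congr rfl fun i _ => ?_
      rw [← intervalIntegral.integral_add (hint k i) (hint2 k i)]
      refine intervalIntegral.integral_congr fun s _ => ?_
      ring
    rw [hS, if_pos rfl, h2, mul_add]
    linarith
  have hlen : ∑ k : Fin 2, ∑ i, ∫ s in (0 : ℝ)..P.length i, P.tangent i s k * P.tangent i s k =
      P.totalLength := by
    rw [Finset.sum_comm, totalLength]
    refine Finset.sum_congr rfl fun i _ => ?_
    rw [← intervalIntegral.integral_finsetSum fun k _ => hint2 k i]
    have h1 : ∫ s in (0 : ℝ)..P.length i, ∑ k, P.tangent i s k * P.tangent i s k =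
        ∫ s in (0 : ℝ)..P.length i, (1 : ℝ) := by
      refine intervalIntegral.integral_congr fun s hs => ?_
      rw [Set.uIcc_of_le (P.length_pos i).le] at hs
      have h2 := EuclideanSpace.norm_sq_eq (P.tangent i s)
      rw [P.norm_tangent i hs] at h2
      simpa [pow_two] using h2.symm
    rw [h1]
    simp
  rw [Matrix.trace, ← hlen]
  simp only [Matrix.diag_apply, hdiag, Fin.sum_univ_two]
  ring

/-- A critical pattern has zero right-hand side, so testing with w_k gives zero energy. Conversely,
zero energy makes the image of w_k in the energy space zero; the equation then leaves only a `pull k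
v` = 0, with a > 0. -/
theorem isCritical_iff_dirichletForm_eq_zero {a : ℝ} (ha : 0 < a) {w : Fin 2 → P.CellFunction}
    (hw : ∀ k, P.IsCorrector a k (w k)) :
    P.IsCritical ↔ ∀ k, dirichletForm a (w k) (w k) = 0 := by
  constructor
  · intro h k
    have h1 := isCorrector_iff.1 (hw k) (w k)
    rwa [h, mul_zero, add_zero] at h1
  · intro h v k
    have h1 := isCorrector_iff.1 (hw k) v
    have h2 := h k
    rw [← inner_energyMap_tuple ha.le, inner_self_eq_zero] at h2
    rw [← inner_energyMap_tuple ha.le, h2, inner_zero_left, zero_add] at h1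
    exact (mul_eq_zero.1 h1).resolve_left ha.ne'

end PeriodicPattern

/-- For a regular 1-periodic pattern the effective diffusion tensor `Σ₀` exists, is unique, has
trace at most `2 + a l`, and the trace is equal to `2 + a l` if and only if the pattern is
balanced. -/
theorem theorem1p2 {n : ℕ} (P : PeriodicPattern n) (hP : P.IsRegular) (a : ℝ) (ha : 0 < a) :
    (∃! S : Matrix (Fin 2) (Fin 2) ℝ, P.IsEffectiveTensor a S) ∧
    ∀ S : Matrix (Fin 2) (Fin 2) ℝ, P.IsEffectiveTensor a S →
      S.trace ≤ 2 + a * P.totalLength ∧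
      (S.trace = 2 + a * P.totalLength ↔ P.IsBalanced) := by
  constructor
  · choose w hw using fun k => P.exists_isCorrector ha k
    exact ⟨Matrix.of fun k l => (if k = l then 1 else 0) +
      a * ∑ i, ∫ s in (0 : ℝ)..P.length i,
        ((w k).traceDeriv i s + P.tangent i s k) * P.tangent i s l,
      ⟨w, hw, fun k l => rfl⟩, fun S hS => hS.unique ha ⟨w, hw, fun k l => rfl⟩⟩
  · rintro S ⟨w, hw, hS⟩
    have htrace := PeriodicPattern.trace_eq_sub_dirichletForm hw hS
    have hnn : ∀ k, 0 ≤ PeriodicPattern.dirichletForm a (w k) (w k) := fun k =>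
      PeriodicPattern.dirichletForm_self_nonneg ha.le (w k)
    have hsum := Finset.sum_nonneg fun k (_ : k ∈ Finset.univ) => hnn k
    refine ⟨by linarith, ?_⟩
    rw [PeriodicPattern.isBalanced_iff_isCritical,
      PeriodicPattern.isCritical_iff_dirichletForm_eq_zero ha hw, htrace, sub_eq_self,
      Finset.sum_eq_zero_iff_of_nonneg fun k _ => hnn k]
    simp
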